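/- Let $\mathcal H$ be a finite-dimensional complex Hilbert space, $\mathfrak S$ the set of density operators on $\mathcal H$ (states), $\log$ the binary logarithm, $0\log 0=0$. Let $\mathcal E=\{\pi_j,\rho_j\}_{j=1}^m$ be an ensemble of states ($\pi$ a probability distribution, $\rho_j\in\mathfrak S$) with average state $\bar\rho=\sum_j\pi_j\rho_j$, let $H(\pi)=-\sum_j\pi_j\log\pi_j$, and let $A(\mathcal E)=\sup_{\mathcal M}I(\mathcal E,\mathcal M)$ be its accessible information, the supremum being over all observables $\mathcal M=\{M_k\}_{k=1}^n$ ($M_k\ge0$, $\sum_kM_k=I$, $n$ arbitrary) and $I(\mathcal E,\mathcal M)=\sum_{j,k}p_{jk}\log\frac{p_{jk}}{\pi_jp_k}$ with $p_{jk}=\pi_j\operatorname{Tr}\rho_jM_k$, $p_k=\sum_jp_{jk}$. Put $$M'_j=\bar\rho^{-1/2}(\pi_j\rho_j)\bar\rho^{-1/2},\qquad K(\sigma)=-\sum_jM'_j\log\operatorname{Tr}\sigma M'_j\quad(\sigma\in\mathfrak S),$$ where $\bar\rho^{-1/2}$ is the generalized inverse of $\bar\rho^{1/2}$ if $\bar\rho$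 is degenerate. If $\operatorname{Tr}\sigma M'_j=0$, the coefficient $-\log\operatorname{Tr}\sigma M'_j$ is $+\infty$ (with $0\cdot\infty=0$): the quadratic form of $K(\sigma)$ is $+\infty$ at $\psi$ unless $M'_j\psi=0$ for all such $j$; the vectors $\psi$ satisfying the latter form the domain of $K(\sigma)$. $\Lambda\le K(\sigma)$ is understood in the sense of quadratic forms. Consider the minimization problem $$\min\Big\{\sum_k\operatorname{Tr}(p_k\sigma_k)K(\sigma_k)\ :\ \{p_k,\sigma_k\}\text{ a finite ensemble of states with }\sum_kp_k\sigma_k=\bar\rho\Big\}\qquad(1)$$ and its dual problem $$\max\{\operatorname{Tr}\bar\rho\Lambda:\ \Lambda^*=\Lambda,\ \Lambda\le K(\sigma)\text{ for all }\sigma\in\mathfrak S\}.\qquad(2)$$ The minimum and the maximum are attained and equal, and the minimum is the same if only ensembles of pure states are admitted in (1). Let $\mathcal E'_0=\{p^0_k,\sigma^0_k\}_{k=1}^n$, $\sigma^0_k=|\phi^0_k\rangle\langle\phi^0_k|$ with unit vectors $\phi_k^0$, be an ensemble of pure states with $\sum_kp^0_k\sigma^0_k=\bar\rho$, and let $\Lambda_0$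 be a Hermitian operator. The following statements are equivalent (and in (i) it makes no difference whether (1) is taken over all ensembles or over pure-state ensembles): (i) $\mathcal E'_0$ is a solution of (1), and $\Lambda_0$ is a solution of (2); (ii) a. $\Lambda_0\le K(\sigma)$ for all $\sigma\in\mathfrak S$; b. for every $k$ with $p^0_k>0$, $\phi^0_k$ belongs to the domain of $K(\sigma^0_k)$ and $[K(\sigma^0_k)-\Lambda_0]\phi^0_k=0$; (iii) a. $-\sum_j\langle\psi|M'_j|\psi\rangle\log\langle\psi|M'_j|\psi\rangle\ \ge\ \langle\psi|\Lambda_0|\psi\rangle$ for all unit vectors $\psi\in\mathcal H$; b. for every $k$ with $p^0_k>0$, equality holds in a. at $\psi=\phi^0_k$. If these statements hold, then the supremum that defines $A(\mathcal E)$ is attained and $$A(\mathcal E)=H(\pi)-\operatorname{Tr}\bar\rho\Lambda_0.$$ -/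

import Mathlib

noncomputable section

namespace AccessibleInfo

variable {H : Type*} [NormedAddCommGroup H] [InnerProductSpace ℂ H] [CompleteSpace H]
  [FiniteDimensional ℂ H]

/-- The (real part of the) trace of an operator. All traces below are traces of products of two
self-adjoint operators, hence real. -/
def tr (A : H →L[ℂ] H) : ℝ := (LinearMap.trace ℂ H (A : H →ₗ[ℂ] H)).re

/-- The expectation `⟨ψ|A|ψ⟩`, which is real for self-adjoint `A`. -/
def expect (A : H →L[ℂ] H) (ψ : H) : ℝ := (inner ℂ ψ (A ψ)).re

/-- Quantum states: density operators, i.e. positive operators of trace one. -/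
structure IsState (ρ : H →L[ℂ] H) : Prop where
  isPositive : ρ.IsPositive
  trace_eq_one : LinearMap.trace ℂ H (ρ : H →ₗ[ℂ] H) = 1

variable (H) in
/-- A finite ensemble of quantum states. -/
structure Ensemble (m : ℕ) where
  weight : Fin m → ℝ
  state : Fin m → H →L[ℂ] H
  weight_nonneg : ∀ j, 0 ≤ weight j
  weight_sum : ∑ j, weight j = 1
  isState : ∀ j, IsState (state j)

/-- The average state of an ensemble. -/
def Ensemble.average {m : ℕ} (E : Ensemble H m) : H →L[ℂ] H :=
  ∑ j, (E.weight j : ℂ) • E.state j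

/-- All members of the ensemble are pure states `|φ⟩⟨φ|`. -/
def Ensemble.IsPure {m : ℕ} (E : Ensemble H m) : Prop :=
  ∀ k, ∃ φ : H, ‖φ‖ = 1 ∧ E.state k = InnerProductSpace.rankOne ℂ φ φ

variable (H) in
/-- Observables with `n` outcomes: positive operators that sum to the unit operator. -/
structure Observable (n : ℕ) where
  op : Fin n → H →L[ℂ] H
  isPositive : ∀ k, (op k).IsPositive
  sum_eq_one : ∑ k, op k = 1

/-- Shannon entropy in bits, with `0 log 0 = 0`. -/
def shannon {m : ℕ} (q : Fin m → ℝ) : ℝ := -∑ j, q j * Real.logb 2 (q j)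

/-- The joint distribution `π_j Tr ρ_j M_k` of input and output. -/
def jointProb {m n : ℕ} (E : Ensemble H m) (M : Observable H n) (j : Fin m) (k : Fin n) : ℝ :=
  E.weight j * tr (E.state j * M.op k)

/-- The Shannon mutual information (in bits) between input and output.
Terms with vanishing joint probability contribute zero. -/
def mutualInfo {m n : ℕ} (E : Ensemble H m) (M : Observable H n) : ℝ :=
  ∑ j, ∑ k, jointProb E M j k *
    Real.logb 2 (jointProb E M j k / (E.weight j * ∑ i, jointProb E M i k))

/-- The values of the mutual information over all observables with finitely many outcomes. -/
def mutualInfoValues {m : ℕ} (E : Ensemble H m) : Set ℝ :=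
  {x | ∃ (n : ℕ) (M : Observable H n), mutualInfo E M = x}

/-- Accessible information of the ensemble. -/
def accessibleInfo {m : ℕ} (E : Ensemble H m) : ℝ := sSup (mutualInfoValues E)

/-- The (generalized) inverse square root of a positive operator: an eigenvalue `x > 0` is replaced
by `x ^ (-1/2)`, and the eigenvalue `0` by `0`. -/
def invSqrt (ρ : H →L[ℂ] H) : H →L[ℂ] H := cfc (fun x : ℝ => (Real.sqrt x)⁻¹) ρ

/-- The operators `M'_j = ρ̄^{-1/2} (π_j ρ_j) ρ̄^{-1/2}`. -/
def Ensemble.dualOp {m : ℕ} (E : Ensemble H m) (j : Fin m) : H →L[ℂ] H :=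
  invSqrt E.average * ((E.weight j : ℂ) • E.state j) * invSqrt E.average

/-- The domain of `K(σ)`. If `Tr σM'_j = 0`, the coefficient `-log Tr σM'_j` is `+∞`, so (with
`0 · ∞ = 0`) the quadratic form of `K(σ)` is finite at `ψ` exactly if `M'_j ψ = 0` for all such
`j`; at all other vectors it is `+∞`. -/
def Ensemble.domK {m : ℕ} (E : Ensemble H m) (σ : H →L[ℂ] H) : Set H :=
  {ψ | ∀ j, tr (σ * E.dualOp j) = 0 → E.dualOp j ψ = 0}

/-- `K(σ) = -∑_j M'_j log Tr σM'_j`, to be applied to vectors of its domain `domK`, where the terms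
with `Tr σM'_j = 0` vanish (as they do here, since `Real.logb 2 0 = 0`). The domain contains the
range of `σ`, for each state `σ`. -/
def Ensemble.K {m : ℕ} (E : Ensemble H m) (σ : H →L[ℂ] H) : H →L[ℂ] H :=
  -∑ j, ((Real.logb 2 (tr (σ * E.dualOp j)) : ℝ) : ℂ) • E.dualOp j

/-- `Λ ≤ K(σ)` in the sense of quadratic forms, the form of `K(σ)` being `+∞` off `domK`. -/
def Ensemble.LeK {m : ℕ} (E : Ensemble H m) (Λ σ : H →L[ℂ] H) : Prop :=
  ∀ ψ ∈ E.domK σ, expect Λ ψ ≤ expect (E.K σ) ψ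

/-- The objective `∑_k Tr (p_k σ_k) K(σ_k)` at an ensemble `{p_k, σ_k}`. -/
def Ensemble.primalValue {m n : ℕ} (E : Ensemble H m) (E' : Ensemble H n) : ℝ :=
  ∑ k, tr (((E'.weight k : ℂ) • E'.state k) * E.K (E'.state k))

/-- `E₀` minimizes the objective among all ensembles with the average state of `E`. -/
def Ensemble.SolvesPrimal {m n : ℕ} (E : Ensemble H m) (E₀ : Ensemble H n) : Prop :=
  E₀.average = E.average ∧
    ∀ (l : ℕ) (E' : Ensemble H l), E'.average = E.average → E.primalValue E₀ ≤ E.primalValue E'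

/-- `E₀` is a pure-state ensemble that minimizes the objective among all pure-state ensembles with
the average state of `E`. -/
def Ensemble.SolvesPurePrimal {m n : ℕ} (E : Ensemble H m) (E₀ : Ensemble H n) : Prop :=
  E₀.average = E.average ∧ E₀.IsPure ∧
    ∀ (l : ℕ) (E' : Ensemble H l), E'.average = E.average → E'.IsPure →
      E.primalValue E₀ ≤ E.primalValue E'

/-- The constraints of the dual problem. -/
def Ensemble.DualFeasible {m : ℕ} (E : Ensemble H m) (Λ : H →L[ℂ] H) : Prop :=
  IsSelfAdjoint Λ ∧ ∀ σ, IsState σ → E.LeK Λ σ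

/-- `Λ₀` solves the dual problem `max {Tr ρ̄Λ : Λ* = Λ, Λ ≤ K(σ) for all states σ}`. -/
def Ensemble.SolvesDual {m : ℕ} (E : Ensemble H m) (Λ₀ : H →L[ℂ] H) : Prop :=
  E.DualFeasible Λ₀ ∧ ∀ Λ, E.DualFeasible Λ → tr (E.average * Λ) ≤ tr (E.average * Λ₀)

/-- The entropy inequality for all unit vectors, with equality at the vectors `φ k` of positive
weight `p k`. -/
def Ensemble.EntropyCondition {m n : ℕ} (E : Ensemble H m) (p : Fin n → ℝ) (φ : Fin n → H)
    (Λ₀ : H →L[ℂ] H) : Prop :=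
  (∀ ψ : H, ‖ψ‖ = 1 → expect Λ₀ ψ ≤ shannon fun j => expect (E.dualOp j) ψ) ∧
    ∀ k, 0 < p k → (shannon fun j => expect (E.dualOp j) (φ k)) = expect Λ₀ (φ k)

end AccessibleInfo

end

namespace AccessibleInfo

open InnerProductSpace

set_option linter.unusedSectionVars false

variable {H : Type*} [NormedAddCommGroup H] [InnerProductSpace ℂ H] [CompleteSpace H]
  [FiniteDimensional ℂ H]

/-! Write h(σ) for `outputEntropy`, the entropy of (Tr σM'_j)_j, and P for the support projection of
ρ̄. An observable M decomposes ρ̄ into p_kσ_k = ρ̄^{1/2}M_kρ̄^{1/2}, and every decomposition of ρ̄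
arises so, up to a null outcome. Under this correspondence I(E,M) = H(π) - ∑ p_k h(σ_k)
(`mutualInfo_eq`, `mutualInfo_dualObservable`). Since Tr σK(σ) = h(σ), the sum is the objective of
the minimization problem.

Weak duality: Λ ≤ K(σ) gives Tr σΛ ≤ h(σ), to be averaged over the ensemble. The duality gap of a
pure ensemble is then a sum of nonnegative terms, so it vanishes iff equality holds at every φ_k of
positive weight (`entropyCondition_iff`).

Strong duality: the convex hull of the graph of h over pure states is compact; Λ comes from a
supporting hyperplane at its lowest point over ρ̄. The hyperplane bounds Λ by h at pure states only.
Gibbs' inequality upgrades this to Λ ≤ K(σ) for all σ (`dualFeasible_of_expect_le`), provided that Λ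
commutes with P and is nonpositive on ker P.

For Λ₀ satisfying the entropy condition this block structure has to be derived. Entropy minus
expectation, made homogeneous, is minimal at φ_k, and stationarity reads K(σ_k)φ_k = Λ₀φ_k
(`K_apply_eq_of_expect_eq`). As K(σ_k) maps into the support and the φ_k span it, Λ₀ preserves it.
-/

/-! ### Functional calculus and support projections -/

theorem finite_real_spectrum (A : H →L[ℂ] H) : (spectrum ℝ A).Finite := by
  have : FiniteDimensional ℝ (H →L[ℂ] H) := FiniteDimensional.complexToReal _
  have hi : IsIntegral ℝ A := Algebra.IsIntegral.isIntegral A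
  refine (Polynomial.finite_setOfPred_isRoot (minpoly.ne_zero hi)).subset fun x hx => ?_
  have h := spectrum.subset_polynomial_aeval A (minpoly ℝ A) ⟨x, hx, rfl⟩
  rw [minpoly.aeval] at h
  by_contra hne
  refine h ?_
  rw [spectrum.mem_resolventSet_iff, sub_zero]
  exact (isUnit_iff_ne_zero.2 hne).map (algebraMap ℝ (H →L[ℂ] H))

/-- `(√x)⁻¹` is discontinuous at 0, and `cfc` has a default value off continuous functions;
finiteness of the spectrum removes the obstacle. -/
theorem continuousOn_real_spectrum (A : H →L[ℂ] H) (f : ℝ → ℝ) :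
    ContinuousOn f (spectrum ℝ A) :=
  (finite_real_spectrum A).continuousOn f

/-- The positive square root of a positive operator. -/
noncomputable def sqrtOp (ρ : H →L[ℂ] H) : H →L[ℂ] H := cfc Real.sqrt ρ

/-- The projection onto the support of a positive operator. -/
noncomputable def suppProj (ρ : H →L[ℂ] H) : H →L[ℂ] H := sqrtOp ρ * invSqrt ρ

section cfc

variable (ρ : H →L[ℂ] H)

theorem isSelfAdjoint_sqrtOp : IsSelfAdjoint (sqrtOp ρ) := cfc_predicate _ _

theorem isSelfAdjoint_invSqrt : IsSelfAdjoint (invSqrt ρ) := cfc_predicate _ _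

theorem suppProj_eq_cfc : suppProj ρ = cfc (fun x : ℝ => √x * (√x)⁻¹) ρ :=
  (cfc_mul _ _ ρ (continuousOn_real_spectrum _ _) (continuousOn_real_spectrum _ _)).symm

theorem invSqrt_mul_sqrtOp : invSqrt ρ * sqrtOp ρ = suppProj ρ := (cfc_commute_cfc _ _ ρ).eq

theorem isSelfAdjoint_suppProj : IsSelfAdjoint (suppProj ρ) := by
  rw [suppProj_eq_cfc]; exact cfc_predicate _ _

theorem suppProj_mul_sqrtOp : suppProj ρ * sqrtOp ρ = sqrtOp ρ := by
  rw [suppProj_eq_cfc, sqrtOp,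
    ← cfc_mul _ _ ρ (continuousOn_real_spectrum _ _) (continuousOn_real_spectrum _ _)]
  congr 1; ext x
  exact mul_inv_mul_cancel _

theorem sqrtOp_mul_suppProj : sqrtOp ρ * suppProj ρ = sqrtOp ρ := by
  have h := congrArg star (suppProj_mul_sqrtOp ρ)
  rwa [star_mul, (isSelfAdjoint_sqrtOp ρ).star_eq, (isSelfAdjoint_suppProj ρ).star_eq] at h

theorem suppProj_mul_invSqrt : suppProj ρ * invSqrt ρ = invSqrt ρ := by
  rw [suppProj_eq_cfc, invSqrt,
    ← cfc_mul _ _ ρ (continuousOn_real_spectrum _ _) (continuousOn_real_spectrum _ _)]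
  congr 1; ext x
  by_cases h : √x = 0
  · simp [h]
  · simp [h]

theorem invSqrt_mul_suppProj : invSqrt ρ * suppProj ρ = invSqrt ρ := by
  have h := congrArg star (suppProj_mul_invSqrt ρ)
  rwa [star_mul, (isSelfAdjoint_invSqrt ρ).star_eq, (isSelfAdjoint_suppProj ρ).star_eq] at h

theorem suppProj_mul_self : suppProj ρ * suppProj ρ = suppProj ρ := by
  conv_lhs => rw [suppProj, ← mul_assoc, mul_assoc, mul_assoc, ← mul_assoc (invSqrt ρ),
    invSqrt_mul_sqrtOp, suppProj_mul_invSqrt]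
  rfl

variable {ρ}

theorem sqrtOp_mul_self (hρ : ρ.IsPositive) : sqrtOp ρ * sqrtOp ρ = ρ := by
  have h0 : 0 ≤ ρ := (ContinuousLinearMap.nonneg_iff_isPositive ρ).2 hρ
  rw [sqrtOp, ← cfc_mul _ _ ρ (continuousOn_real_spectrum _ _) (continuousOn_real_spectrum _ _)]
  conv_rhs => rw [← cfc_id ℝ ρ hρ.isSelfAdjoint]
  exact cfc_congr fun x hx => Real.mul_self_sqrt (spectrum_nonneg_of_nonneg h0 hx)

theorem suppProj_mul_op (hρ : ρ.IsPositive) : suppProj ρ * ρ = ρ := by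
  calc suppProj ρ * ρ = suppProj ρ * sqrtOp ρ * sqrtOp ρ := by rw [mul_assoc, sqrtOp_mul_self hρ]
    _ = ρ := by rw [suppProj_mul_sqrtOp, sqrtOp_mul_self hρ]

theorem invSqrt_mul_op_mul_invSqrt (hρ : ρ.IsPositive) : invSqrt ρ * ρ * invSqrt ρ = suppProj ρ := by
  calc invSqrt ρ * ρ * invSqrt ρ = invSqrt ρ * sqrtOp ρ * sqrtOp ρ * invSqrt ρ := by
        rw [mul_assoc (invSqrt ρ) (sqrtOp ρ) (sqrtOp ρ), sqrtOp_mul_self hρ]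
    _ = suppProj ρ := by rw [invSqrt_mul_sqrtOp, suppProj_mul_sqrtOp, suppProj]

end cfc

/-! ### Traces, expectations and states -/

section trace

theorem tr_add (A B : H →L[ℂ] H) : tr (A + B) = tr A + tr B := by simp [tr]

theorem tr_smul (c : ℝ) (A : H →L[ℂ] H) : tr ((c : ℂ) • A) = c * tr A := by simp [tr]

/-- The real part of the trace as a real-linear functional. -/
noncomputable def trLinear : (H →L[ℂ] H) →ₗ[ℝ] ℝ where
  toFun := tr
  map_add' := tr_add
  map_smul' c A := by
    rw [← Complex.coe_smul c A, tr_smul]; rfl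

theorem trLinear_apply (A : H →L[ℂ] H) : trLinear A = tr A := rfl

theorem tr_sum {ι : Type*} (s : Finset ι) (A : ι → H →L[ℂ] H) :
    tr (∑ i ∈ s, A i) = ∑ i ∈ s, tr (A i) := map_sum trLinear A s

theorem tr_neg (A : H →L[ℂ] H) : tr (-A) = -tr A := map_neg trLinear A

theorem tr_sub (A B : H →L[ℂ] H) : tr (A - B) = tr A - tr B := map_sub trLinear A B

theorem tr_mul_comm (A B : H →L[ℂ] H) : tr (A * B) = tr (B * A) := by
  unfold tr
  congr 1
  exact LinearMap.trace_mul_comm ℂ (A : H →ₗ[ℂ] H) (B : H →ₗ[ℂ] H)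

theorem tr_rankOne_mul (φ : H) (B : H →L[ℂ] H) : tr (rankOne ℂ φ φ * B) = expect B φ := by
  rw [tr_mul_comm]
  have : B * rankOne ℂ φ φ = rankOne ℂ (B φ) φ := by
    ext x; simp
  rw [this, tr, trace_rankOne]; rfl

theorem tr_rankOne (φ : H) : tr (rankOne ℂ φ φ) = ‖φ‖ ^ 2 := by
  rw [tr, trace_rankOne, inner_self_eq_norm_sq_to_K]; norm_cast

theorem IsState.tr_eq_one {σ : H →L[ℂ] H} (h : IsState σ) : tr σ = 1 := by
  rw [tr, h.trace_eq_one]; rfl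

theorem isState_of_tr {σ : H →L[ℂ] H} (h : σ.IsPositive) (h1 : tr σ = 1) : IsState σ := by
  refine ⟨h, Complex.ext h1 ?_⟩
  have := LinearMap.IsPositive.trace_nonneg h.toLinearMap
  simpa using (Complex.le_def.1 this).2.symm

theorem isState_rankOne {φ : H} (h : ‖φ‖ = 1) : IsState (rankOne ℂ φ φ) :=
  isState_of_tr (isPositive_rankOne_self φ) (by simp [tr_rankOne, h])

end trace

section expect

theorem expect_add (A B : H →L[ℂ] H) (ψ : H) : expect (A + B) ψ = expect A ψ + expect B ψ := by
  simp [expect]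

theorem expect_sub (A B : H →L[ℂ] H) (ψ : H) : expect (A - B) ψ = expect A ψ - expect B ψ := by
  simp [expect]

theorem expect_ofReal_smul (c : ℝ) (A : H →L[ℂ] H) (ψ : H) :
    expect ((c : ℂ) • A) ψ = c * expect A ψ := by
  simp [expect]

theorem expect_sum {ι : Type*} (s : Finset ι) (A : ι → H →L[ℂ] H) (ψ : H) :
    expect (∑ i ∈ s, A i) ψ = ∑ i ∈ s, expect (A i) ψ := by
  simp [expect]

theorem expect_one (ψ : H) : expect (1 : H →L[ℂ] H) ψ = ‖ψ‖ ^ 2 := by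
  simp [expect, inner_self_eq_norm_sq_to_K]; norm_cast

theorem expect_smul (A : H →L[ℂ] H) (c : ℝ) (ψ : H) :
    expect A ((c : ℂ) • ψ) = c ^ 2 * expect A ψ := by
  simp [expect]; ring

theorem expect_zero (A : H →L[ℂ] H) : expect A 0 = 0 := by simp [expect]

theorem inner_apply_left {S : H →L[ℂ] H} (hS : IsSelfAdjoint S) (x y : H) :
    inner ℂ (S x) y = inner ℂ x (S y) := by
  conv_lhs => rw [← hS.adjoint_eq, ContinuousLinearMap.adjoint_inner_left]

theorem expect_conj {S : H →L[ℂ] H} (hS : IsSelfAdjoint S) (A : H →L[ℂ] H) (ψ : H) :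
    expect (S * A * S) ψ = expect A (S ψ) := by
  simp only [expect, mul_apply_eq_comp, inner_apply_left hS]

theorem isPositive_conj {S A : H →L[ℂ] H} (hS : IsSelfAdjoint S) (hA : A.IsPositive) :
    (S * A * S).IsPositive := by
  have := hA.conj_adjoint S
  rwa [hS.adjoint_eq] at this

theorem conj_rankOne {S : H →L[ℂ] H} (hS : IsSelfAdjoint S) (ψ : H) :
    S * rankOne ℂ ψ ψ * S = rankOne ℂ (S ψ) (S ψ) := by
  ext x
  simp [inner_apply_left hS]

theorem expect_nonneg {A : H →L[ℂ] H} (hA : A.IsPositive) (ψ : H) : 0 ≤ expect A ψ :=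
  hA.re_inner_nonneg_right ψ

/-- ⟨ψ|A|ψ⟩ = ‖A^{1/2}ψ‖². -/
theorem apply_eq_zero_of_expect_eq_zero {A : H →L[ℂ] H} (hA : A.IsPositive) {ψ : H}
    (h : expect A ψ = 0) : A ψ = 0 := by
  have h0 : expect (sqrtOp A * 1 * sqrtOp A) ψ = 0 := by
    rwa [mul_one, sqrtOp_mul_self hA]
  rw [expect_conj (isSelfAdjoint_sqrtOp A), expect_one, sq_eq_zero_iff, norm_eq_zero] at h0
  rw [← sqrtOp_mul_self hA, mul_apply_eq_comp, h0, map_zero]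

theorem tr_mul_nonneg {A B : H →L[ℂ] H} (hA : A.IsPositive) (hB : B.IsPositive) :
    0 ≤ tr (A * B) := by
  obtain ⟨n, u, rfl⟩ := ContinuousLinearMap.isPositive_iff_eq_sum_rankOne.1 hA
  rw [Finset.sum_mul, tr_sum]
  exact Finset.sum_nonneg fun i _ => by rw [tr_rankOne_mul]; exact expect_nonneg hB _

theorem tr_nonneg {A : H →L[ℂ] H} (hA : A.IsPositive) : 0 ≤ tr A := by
  simpa using tr_mul_nonneg hA ContinuousLinearMap.isPositive_one

theorem eq_zero_of_tr_eq_zero {A : H →L[ℂ] H} (hA : A.IsPositive) (h : tr A = 0) : A = 0 := by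
  obtain ⟨n, u, rfl⟩ := ContinuousLinearMap.isPositive_iff_eq_sum_rankOne.1 hA
  rw [tr_sum, Finset.sum_eq_zero_iff_of_nonneg fun i _ => by rw [tr_rankOne]; positivity] at h
  refine Finset.sum_eq_zero fun i hi => ?_
  have := h i hi
  rw [tr_rankOne, sq_eq_zero_iff, norm_eq_zero] at this
  simp [this]

theorem isPositive_ofReal_smul {c : ℝ} (hc : 0 ≤ c) {A : H →L[ℂ] H} (hA : A.IsPositive) :
    ((c : ℂ) • A).IsPositive :=
  hA.smul_of_nonneg (by exact_mod_cast hc)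

/-- Positive operators are multiples of states, as soon as there are states. -/
theorem exists_eq_smul_isState {ρ : H →L[ℂ] H} (hρ : IsState ρ) {A : H →L[ℂ] H}
    (hA : A.IsPositive) : ∃ σ, IsState σ ∧ A = (tr A : ℂ) • σ := by
  by_cases h : tr A = 0
  · exact ⟨ρ, hρ, by rw [h, Complex.ofReal_zero, zero_smul, eq_zero_of_tr_eq_zero hA h]⟩
  · refine ⟨((tr A)⁻¹ : ℝ) • A, ?_, ?_⟩
    · rw [← Complex.coe_smul]
      refine isState_of_tr (isPositive_ofReal_smul (inv_nonneg.2 (tr_nonneg hA)) hA) ?_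
      rw [tr_smul, inv_mul_cancel₀ h]
    · rw [Complex.coe_smul, smul_smul, mul_inv_cancel₀ h, one_smul]

/-- States are mixtures of pure states. -/
theorem IsState.exists_pure_decomposition {σ : H →L[ℂ] H} (hσ : IsState σ) :
    ∃ (n : ℕ) (w : Fin n → ℝ) (φ : Fin n → H), (∀ i, 0 ≤ w i) ∧ ∑ i, w i = 1 ∧
      (∀ i, ‖φ i‖ = 1) ∧ σ = ∑ i, (w i : ℂ) • rankOne ℂ (φ i) (φ i) := by
  classical
  obtain ⟨n, u, hu⟩ := ContinuousLinearMap.isPositive_iff_eq_sum_rankOne.1 hσ.isPositive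
  have hsum : ∑ i, ‖u i‖ ^ 2 = 1 := by
    rw [← hσ.tr_eq_one, hu, tr_sum]
    simp only [tr_rankOne]
  have : Nontrivial H := by
    by_contra hn
    rw [not_nontrivial_iff_subsingleton] at hn
    have : ∀ i, u i = 0 := fun i => Subsingleton.elim _ _
    simp [this] at hsum
  -- A vector `u i = 0` has weight zero; `e` stands in for its direction.
  obtain ⟨e, he⟩ := exists_norm_eq H zero_le_one
  refine ⟨n, fun i => ‖u i‖ ^ 2, fun i => if u i = 0 then e else ((‖u i‖⁻¹ : ℝ) : ℂ) • u i,
    fun i => by positivity, hsum, fun i => ?_, ?_⟩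
  · by_cases h : u i = 0
    · simp [h, he]
    · simp [h, norm_smul]
  · rw [hu]
    refine Finset.sum_congr rfl fun i _ => ?_
    by_cases h : u i = 0
    · simp [h]
    · have h' : (‖u i‖ : ℂ) ≠ 0 := by exact_mod_cast norm_ne_zero_iff.2 h
      ext x
      simp only [h, if_false, smul_apply, rankOne_apply, inner_smul_left, smul_smul]
      congr 1
      simp
      field_simp

end expect

/-- Gibbs' inequality for subnormalized distributions. -/
theorem shannon_le_cross_entropy {m : ℕ} {q s : Fin m → ℝ} (hq : ∀ j, 0 ≤ q j) (hs : ∀ j, 0 ≤ s j)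
    (hqs : ∀ j, s j = 0 → q j = 0) (hsum : ∑ j, s j ≤ ∑ j, q j) :
    shannon q ≤ -∑ j, q j * Real.logb 2 (s j) := by
  -- This is log x ≤ x - 1 at x = s_j/q_j, multiplied by q_j.
  have key : ∀ j, q j * Real.log (s j) - q j * Real.log (q j) ≤ s j - q j := by
    intro j
    rcases (hq j).eq_or_lt with h | h
    · simpa [← h] using hs j
    · have hsj : 0 < s j := (hs j).lt_of_ne fun h0 => h.ne' (hqs j h0.symm)
      have := Real.log_le_sub_one_of_pos (div_pos hsj h)
      rw [Real.log_div hsj.ne' h.ne'] at this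
      have := mul_le_mul_of_nonneg_left this h.le
      rw [mul_sub, mul_sub, mul_one, mul_div_cancel₀ _ h.ne'] at this
      exact this
  have h := Finset.sum_le_sum fun j (_ : j ∈ Finset.univ) => key j
  rw [Finset.sum_sub_distrib, Finset.sum_sub_distrib] at h
  have h2 : 0 < Real.log 2 := Real.log_pos one_lt_two
  simp only [shannon, Real.logb, ← mul_div_assoc, ← Finset.sum_div, ← neg_div]
  rw [div_le_div_iff_of_pos_right h2]
  linarith

theorem shannon_mul {m : ℕ} (c : ℝ) (q : Fin m → ℝ) :
    shannon (fun j => c * q j) = c * shannon q - (∑ j, q j) * (c * Real.logb 2 c) := by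
  by_cases hc : c = 0
  · simp [hc, shannon]
  simp only [shannon, mul_neg, Finset.mul_sum, Finset.sum_mul]
  rw [← Finset.sum_neg_distrib, ← Finset.sum_neg_distrib, ← Finset.sum_sub_distrib]
  refine Finset.sum_congr rfl fun j _ => ?_
  by_cases hq : q j = 0
  · simp [hq]
  · rw [Real.logb_mul hc hq]; ring

/-- An invariant subspace of a self-adjoint operator is reducing: take adjoints. -/
theorem isSelfAdjoint_mul_comm_of_apply {Λ P : H →L[ℂ] H} (hΛ : IsSelfAdjoint Λ)
    (hP : IsSelfAdjoint P) (h : P * Λ * P = Λ * P) : Λ * P = P * Λ := by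
  have h' := congrArg star h
  rw [star_mul, star_mul, star_mul, hΛ.star_eq, hP.star_eq, ← mul_assoc, h] at h'
  exact h'

theorem isPositive_one_sub_suppProj (ρ : H →L[ℂ] H) : (1 - suppProj ρ).IsPositive := by
  have := isPositive_conj ((IsSelfAdjoint.one _).sub (isSelfAdjoint_suppProj ρ))
    ContinuousLinearMap.isPositive_one
  rw [mul_one, mul_sub, mul_one, sub_mul, one_mul, suppProj_mul_self, sub_self, sub_zero] at this
  exact this

/-! ### The operators M'_j, weak duality and Gibbs' inequality -/

namespace Ensemble

variable {m : ℕ} (E : Ensemble H m)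

theorem isState_average : IsState E.average := by
  refine isState_of_tr (ContinuousLinearMap.isPositive_sum _ fun j _ =>
    isPositive_ofReal_smul (E.weight_nonneg j) (E.isState j).isPositive) ?_
  simp only [average, tr_sum, tr_smul, (E.isState _).tr_eq_one, mul_one, E.weight_sum]

theorem isPositive_average : E.average.IsPositive := E.isState_average.isPositive

/-- The projection onto the support of the average state. -/
noncomputable abbrev supp : H →L[ℂ] H := suppProj E.average

/-- From 0 ≤ π_jρ_j ≤ ρ̄, the kernel of ρ̄ lies in that of π_jρ_j. The weight must stay: a state of
weight zero is unrestricted. -/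
theorem weight_smul_state_mul_supp (j : Fin m) :
    ((E.weight j : ℂ) • E.state j) * E.supp = (E.weight j : ℂ) • E.state j := by
  have hpos : ∀ i, ((E.weight i : ℂ) • E.state i).IsPositive := fun i =>
    isPositive_ofReal_smul (E.weight_nonneg i) (E.isState i).isPositive
  have hker : E.average * (1 - E.supp) = 0 := by
    have h := congrArg star (suppProj_mul_op E.isPositive_average)
    rw [star_mul, (isSelfAdjoint_suppProj _).star_eq, E.isPositive_average.isSelfAdjoint.star_eq]
      at h
    rw [mul_sub, mul_one, h, sub_self]
  have hzero : ((E.weight j : ℂ) • E.state j) * (1 - E.supp) = 0 := by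
    ext ψ
    refine apply_eq_zero_of_expect_eq_zero (hpos j) ?_
    have h : expect E.average ((1 - E.supp) ψ) = 0 := by
      rw [expect, ← mul_apply_eq_comp, hker]; simp
    rw [average, expect_sum, Finset.sum_eq_zero_iff_of_nonneg fun i _ => expect_nonneg (hpos i) _]
      at h
    exact h j (Finset.mem_univ j)
  rw [mul_sub, mul_one, sub_eq_zero] at hzero
  exact hzero.symm

theorem supp_mul_weight_smul_state (j : Fin m) :
    E.supp * ((E.weight j : ℂ) • E.state j) = (E.weight j : ℂ) • E.state j := by
  have h := congrArg star (E.weight_smul_state_mul_supp j)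
  rwa [star_mul, (isSelfAdjoint_suppProj _).star_eq, (isPositive_ofReal_smul (E.weight_nonneg j)
    (E.isState j).isPositive).isSelfAdjoint.star_eq] at h

theorem supp_mul_state {j : Fin m} (hj : 0 < E.weight j) : E.supp * E.state j = E.state j := by
  have h := E.supp_mul_weight_smul_state j
  rw [mul_smul_comm] at h
  exact smul_right_injective _ (by exact_mod_cast hj.ne') h

theorem supp_apply_of_state_eq_rankOne {j : Fin m} (hj : 0 < E.weight j) {φ : H} (hφ : ‖φ‖ = 1)
    (h : E.state j = rankOne ℂ φ φ) : E.supp φ = φ := by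
  have h1 : E.state j φ = φ := by
    rw [h, rankOne_apply, inner_self_eq_norm_sq_to_K, hφ]; simp
  conv_lhs => rw [← h1, ← mul_apply_eq_comp, E.supp_mul_state hj, h1]

theorem isPositive_dualOp (j : Fin m) : (E.dualOp j).IsPositive :=
  isPositive_conj (isSelfAdjoint_invSqrt _)
    (isPositive_ofReal_smul (E.weight_nonneg j) (E.isState j).isPositive)

theorem sum_dualOp : ∑ j, E.dualOp j = E.supp := by
  simp only [dualOp, ← Finset.sum_mul, ← Finset.mul_sum]
  exact invSqrt_mul_op_mul_invSqrt E.isPositive_average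

theorem sqrtOp_mul_dualOp_mul_sqrtOp (j : Fin m) :
    sqrtOp E.average * E.dualOp j * sqrtOp E.average = (E.weight j : ℂ) • E.state j := by
  calc sqrtOp E.average * E.dualOp j * sqrtOp E.average
      = E.supp * ((E.weight j : ℂ) • E.state j) * (invSqrt E.average * sqrtOp E.average) := by
        simp only [dualOp, suppProj, mul_assoc]
    _ = _ := by rw [invSqrt_mul_sqrtOp, supp_mul_weight_smul_state, weight_smul_state_mul_supp]

theorem dualOp_mul_supp (j : Fin m) : E.dualOp j * E.supp = E.dualOp j := by
  rw [dualOp, mul_assoc, invSqrt_mul_suppProj]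

theorem supp_mul_dualOp (j : Fin m) : E.supp * E.dualOp j = E.dualOp j := by
  rw [dualOp, ← mul_assoc, ← mul_assoc, suppProj_mul_invSqrt]

theorem expect_dualOp_supp (j : Fin m) (ψ : H) :
    expect (E.dualOp j) (E.supp ψ) = expect (E.dualOp j) ψ := by
  rw [← expect_conj (isSelfAdjoint_suppProj _), supp_mul_dualOp, dualOp_mul_supp]

theorem sum_expect_dualOp (ψ : H) : ∑ j, expect (E.dualOp j) ψ = ‖E.supp ψ‖ ^ 2 := by
  rw [← expect_sum, sum_dualOp, ← expect_one, ← expect_conj (isSelfAdjoint_suppProj _), mul_one,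
    suppProj_mul_self]

/-- The entropy of the distribution `Tr σM'_j`. -/
noncomputable def outputEntropy (σ : H →L[ℂ] H) : ℝ := shannon fun j => tr (σ * E.dualOp j)

theorem outputEntropy_rankOne (ψ : H) :
    E.outputEntropy (rankOne ℂ ψ ψ) = shannon fun j => expect (E.dualOp j) ψ := by
  simp only [outputEntropy, tr_rankOne_mul]

theorem tr_mul_K (A σ : H →L[ℂ] H) :
    tr (A * E.K σ) = -∑ j, tr (A * E.dualOp j) * Real.logb 2 (tr (σ * E.dualOp j)) := by
  simp only [K, mul_neg, tr_neg, Finset.mul_sum, tr_sum, mul_smul_comm, tr_smul]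
  simp only [mul_comm]

theorem expect_K (σ : H →L[ℂ] H) (ψ : H) :
    expect (E.K σ) ψ = -∑ j, expect (E.dualOp j) ψ * Real.logb 2 (tr (σ * E.dualOp j)) := by
  rw [← tr_rankOne_mul, tr_mul_K]
  simp only [tr_rankOne_mul]

theorem tr_self_mul_K (σ : H →L[ℂ] H) : tr (σ * E.K σ) = E.outputEntropy σ := E.tr_mul_K σ σ

theorem primalValue_eq {n : ℕ} (E' : Ensemble H n) :
    E.primalValue E' = ∑ k, E'.weight k * E.outputEntropy (E'.state k) := by
  simp only [primalValue, smul_mul_assoc, tr_smul, tr_self_mul_K]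

theorem tr_average_mul (Λ : H →L[ℂ] H) :
    tr (E.average * Λ) = ∑ k, E.weight k * tr (E.state k * Λ) := by
  simp only [average, Finset.sum_mul, tr_sum, smul_mul_assoc, tr_smul]

theorem tr_mul_dualOp_nonneg {σ : H →L[ℂ] H} (hσ : σ.IsPositive) (j : Fin m) :
    0 ≤ tr (σ * E.dualOp j) := tr_mul_nonneg hσ (E.isPositive_dualOp j)

theorem sum_tr_mul_dualOp (σ : H →L[ℂ] H) : ∑ j, tr (σ * E.dualOp j) = tr (σ * E.supp) := by
  rw [← tr_sum, ← Finset.mul_sum, sum_dualOp]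

theorem sum_tr_mul_dualOp_le_one {σ : H →L[ℂ] H} (hσ : IsState σ) :
    ∑ j, tr (σ * E.dualOp j) ≤ 1 := by
  have h := tr_mul_nonneg hσ.isPositive (isPositive_one_sub_suppProj E.average)
  rw [mul_sub, mul_one, tr_sub, hσ.tr_eq_one] at h
  rw [sum_tr_mul_dualOp]
  linarith

theorem mem_domK_rankOne (φ : H) : φ ∈ E.domK (rankOne ℂ φ φ) := fun j hj =>
  apply_eq_zero_of_expect_eq_zero (E.isPositive_dualOp j) (by rwa [tr_rankOne_mul] at hj)

theorem DualFeasible.expect_le {E : Ensemble H m} {Λ : H →L[ℂ] H} (h : E.DualFeasible Λ) {φ : H}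
    (hφ : ‖φ‖ = 1) : expect Λ φ ≤ shannon fun j => expect (E.dualOp j) φ := by
  have := h.2 _ (isState_rankOne hφ) φ (E.mem_domK_rankOne φ)
  rwa [← tr_rankOne_mul φ (E.K _), tr_self_mul_K, outputEntropy_rankOne] at this

/-- With σ = ∑ |u_i⟩⟨u_i|, Tr σM'_j = 0 forces ⟨u_i|M'_j|u_i⟩ = 0. So all u_i lie in the domain of
K(σ), and the form inequalities add up. -/
theorem DualFeasible.tr_mul_le {E : Ensemble H m} {Λ σ : H →L[ℂ] H} (h : E.DualFeasible Λ)
    (hσ : IsState σ) : tr (σ * Λ) ≤ E.outputEntropy σ := by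
  obtain ⟨n, u, hu⟩ := ContinuousLinearMap.isPositive_iff_eq_sum_rankOne.1 hσ.isPositive
  have hA : ∀ A : H →L[ℂ] H, tr (σ * A) = ∑ i, expect A (u i) := fun A => by
    simp only [hu, Finset.sum_mul, tr_sum, tr_rankOne_mul]
  rw [← tr_self_mul_K, hA, hA]
  refine Finset.sum_le_sum fun i _ => h.2 σ hσ _ fun j hj => ?_
  rw [hA, Finset.sum_eq_zero_iff_of_nonneg fun i _ => expect_nonneg (E.isPositive_dualOp j) _] at hj
  exact apply_eq_zero_of_expect_eq_zero (E.isPositive_dualOp j) (hj i (Finset.mem_univ i))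

/-- Weak duality. -/
theorem DualFeasible.tr_average_mul_le {E : Ensemble H m} {Λ : H →L[ℂ] H} (h : E.DualFeasible Λ)
    {n : ℕ} {E' : Ensemble H n} (hE' : E'.average = E.average) :
    tr (E.average * Λ) ≤ E.primalValue E' := by
  rw [← hE', tr_average_mul, primalValue_eq]
  exact Finset.sum_le_sum fun k _ =>
    mul_le_mul_of_nonneg_left (h.tr_mul_le (E'.isState k)) (E'.weight_nonneg k)

/-- For operators that are block diagonal with respect to the support of the average state, the
dual constraints can be tested on unit vectors of the support. -/
theorem dualFeasible_of_expect_le {Λ : H →L[ℂ] H} (hΛ : IsSelfAdjoint Λ)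
    (hcomm : Λ * E.supp = E.supp * Λ) (hker : ∀ η, E.supp η = 0 → expect Λ η ≤ 0)
    (hle : ∀ ψ, ‖ψ‖ = 1 → E.supp ψ = ψ →
      expect Λ ψ ≤ shannon fun j => expect (E.dualOp j) ψ) : E.DualFeasible Λ := by
  refine ⟨hΛ, fun σ hσ ψ hψ => ?_⟩
  set P := E.supp with hP
  have hPsa : IsSelfAdjoint P := isSelfAdjoint_suppProj _
  have hPP : ∀ x, P (P x) = P x := fun x => by
    rw [← mul_apply_eq_comp, suppProj_mul_self]
  -- Commutation with P removes the cross terms.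
  have hsplit : expect Λ ψ = expect Λ (P ψ) + expect Λ (ψ - P ψ) := by
    have h1 : ∀ x, inner ℂ x (Λ (P ψ)) = inner ℂ (P x) (Λ ψ) := fun x => by
      rw [inner_apply_left hPsa, ← mul_apply_eq_comp, ← mul_apply_eq_comp, hcomm]
    simp only [expect, map_sub, inner_sub_left, inner_sub_right, h1, hPP]
    simp
  have hk : expect Λ (ψ - P ψ) ≤ 0 := hker _ (by rw [map_sub, hPP, sub_self])
  have hmain : expect Λ (P ψ) ≤ expect (E.K σ) ψ := by
    rw [expect_K]
    simp only [← E.expect_dualOp_supp _ ψ]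
    rw [← hP]
    by_cases h0 : P ψ = 0
    · simp [h0, expect_zero]
    set c := ‖P ψ‖ with hc
    have hc0 : c ≠ 0 := norm_ne_zero_iff.2 h0
    set χ : H := ((c⁻¹ : ℝ) : ℂ) • P ψ with hχ
    have hχ1 : ‖χ‖ = 1 := by
      rw [hχ, norm_smul, Complex.norm_real, norm_inv, hc, norm_norm, inv_mul_cancel₀ hc0]
    have hχP : P χ = χ := by rw [hχ, map_smul, hPP]
    have hback : P ψ = (c : ℂ) • χ := by
      rw [hχ, smul_smul, ← Complex.ofReal_mul, mul_inv_cancel₀ hc0, Complex.ofReal_one, one_smul]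
    -- The distribution at χ has total mass 1, since χ is a unit vector of the support, while that
    -- of σ has mass Tr σP ≤ 1.
    have hgibbs : (shannon fun j => expect (E.dualOp j) χ) ≤
        -∑ j, expect (E.dualOp j) χ * Real.logb 2 (tr (σ * E.dualOp j)) := by
      refine shannon_le_cross_entropy (fun j => expect_nonneg (E.isPositive_dualOp j) _)
        (fun j => E.tr_mul_dualOp_nonneg hσ.isPositive j) (fun j hj => ?_) ?_
      · have h3 : E.dualOp j χ = 0 := by
          rw [hχ, map_smul, ← mul_apply_eq_comp, hP, dualOp_mul_supp, hψ j hj, smul_zero]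
        simp [expect, h3]
      · rw [sum_expect_dualOp, ← hP, hχP, hχ1, one_pow]
        exact E.sum_tr_mul_dualOp_le_one hσ
    have h4 := mul_le_mul_of_nonneg_left ((hle χ hχ1 hχP).trans hgibbs) (sq_nonneg c)
    rw [hback, expect_smul]
    simp only [expect_smul, mul_assoc, ← Finset.mul_sum]
    linarith
  linarith

end Ensemble

/-! ### First-order condition at points of equality -/

theorem hasDerivAt_quadratic_zero (a b c : ℝ) :
    HasDerivAt (fun t : ℝ => a + t * b + t ^ 2 * c) b 0 := by
  have h := (((hasDerivAt_id (0 : ℝ)).mul_const b).const_add a).add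
    (((hasDerivAt_id (0 : ℝ)).pow 2).mul_const c)
  convert! h using 1
  simp

/-- Entropy terms `-q log q` are differentiable along quadratic curves `q` that vanish to second
order at their zeros. -/
theorem hasDerivAt_negMulLog_quadratic {a b : ℝ} (c : ℝ) (hab : a = 0 → b = 0) :
    HasDerivAt (fun t : ℝ => Real.negMulLog (a + t * b + t ^ 2 * c))
      (b * (-Real.log a - 1)) 0 := by
  by_cases ha : a = 0
  · rw [ha, hab ha, zero_mul]
    -- The product rule for `negMulLog` turns its value at t²c into t times a continuous function
    -- vanishing at 0.
    have h : HasDerivAt (fun t : ℝ => t * (2 * Real.negMulLog t * c + t * Real.negMulLog c)) 0 0 := by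
      rw [hasDerivAt_iff_tendsto_slope_zero]
      have hc : Continuous fun t : ℝ => 2 * Real.negMulLog t * c + t * Real.negMulLog c := by
        fun_prop
      have := (hc.tendsto 0).mono_left (nhdsWithin_le_nhds (s := {0}ᶜ))
      simp only [Real.negMulLog_zero, mul_zero, zero_mul, add_zero] at this
      refine this.congr' ?_
      filter_upwards [self_mem_nhdsWithin] with t ht
      have ht : t ≠ 0 := ht
      simp [ht]
    convert! h using 1
    ext t
    rw [mul_zero, zero_add, zero_add, Real.negMulLog_mul, sq, Real.negMulLog_mul]
    ring
  · have h1 : HasDerivAt Real.negMulLog (-Real.log a - 1) (a + 0 * b + 0 ^ 2 * c) := by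
      simpa using Real.hasDerivAt_negMulLog ha
    have := h1.comp (0 : ℝ) (hasDerivAt_quadratic_zero a b c)
    rwa [mul_comm] at this

theorem expect_add_smul {A : H →L[ℂ] H} (hA : IsSelfAdjoint A) (φ η : H) (t : ℝ) :
    expect A (φ + (t : ℂ) • η) =
      expect A φ + t * (2 * (inner ℂ η (A φ)).re) + t ^ 2 * expect A η := by
  have h : (inner ℂ φ (A η)).re = (inner ℂ η (A φ)).re := by
    rw [← inner_apply_left hA, ← inner_conj_symm, Complex.conj_re]
  simp only [expect, map_add, map_smul, inner_add_left, inner_add_right, inner_smul_left,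
    inner_smul_right, Complex.add_re, Complex.conj_ofReal, Complex.re_ofReal_mul, h]
  ring

theorem shannon_mul_log_two {m : ℕ} (q : Fin m → ℝ) :
    shannon q * Real.log 2 = ∑ j, Real.negMulLog (q j) := by
  have h2 : Real.log 2 ≠ 0 := (Real.log_pos one_lt_two).ne'
  simp only [shannon, Real.logb, Real.negMulLog, neg_mul, Finset.sum_mul, Finset.sum_neg_distrib]
  congr 1
  refine Finset.sum_congr rfl fun j _ => ?_
  field_simp

namespace Ensemble

variable {m : ℕ} (E : Ensemble H m)

/-- Scaling by ‖ψ‖² frees the inequality from normalization, so that it can be differentiated along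
lines φ + tη. The logarithm comes from `shannon_mul`. -/
theorem expect_le_shannon_add {Λ : H →L[ℂ] H}
    (hle : ∀ ψ : H, ‖ψ‖ = 1 → expect Λ ψ ≤ shannon fun j => expect (E.dualOp j) ψ) (ψ : H) :
    expect Λ ψ ≤ (shannon fun j => expect (E.dualOp j) ψ) +
      (∑ j, expect (E.dualOp j) ψ) * Real.logb 2 (‖ψ‖ ^ 2) := by
  by_cases h0 : ψ = 0
  · simp [h0, expect_zero, shannon]
  set c := ‖ψ‖ with hc
  have hc0 : c ≠ 0 := norm_ne_zero_iff.2 h0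
  obtain ⟨χ, hχ1, hback⟩ : ∃ χ : H, ‖χ‖ = 1 ∧ ψ = (c : ℂ) • χ := by
    refine ⟨((c⁻¹ : ℝ) : ℂ) • ψ, ?_, ?_⟩
    · rw [norm_smul, Complex.norm_real, norm_inv, hc, norm_norm, inv_mul_cancel₀ hc0]
    · rw [smul_smul, ← Complex.ofReal_mul, mul_inv_cancel₀ hc0, Complex.ofReal_one, one_smul]
  have h := mul_le_mul_of_nonneg_left (hle χ hχ1) (sq_nonneg c)
  rw [hback, expect_smul]
  simp only [expect_smul, shannon_mul, ← Finset.mul_sum]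
  linarith

theorem K_apply_eq_of_expect_eq {Λ : H →L[ℂ] H} (hΛ : IsSelfAdjoint Λ)
    (hle : ∀ ψ : H, ‖ψ‖ = 1 → expect Λ ψ ≤ shannon fun j => expect (E.dualOp j) ψ)
    {φ : H} (hφ : ‖φ‖ = 1) (hφP : E.supp φ = φ)
    (heq : (shannon fun j => expect (E.dualOp j) φ) = expect Λ φ) :
    E.K (rankOne ℂ φ φ) φ = Λ φ := by
  have hlog2 : 0 < Real.log 2 := Real.log_pos one_lt_two
  have hsa : ∀ j, IsSelfAdjoint (E.dualOp j) := fun j => (E.isPositive_dualOp j).isSelfAdjoint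
  -- Real parts suffice: take η to be the difference of the two vectors.
  suffices hkey : ∀ η : H, (inner ℂ η (E.K (rankOne ℂ φ φ) φ)).re = (inner ℂ η (Λ φ)).re by
    have h := sub_eq_zero.2 (hkey (E.K (rankOne ℂ φ φ) φ - Λ φ))
    rw [← Complex.sub_re, ← inner_sub_right] at h
    have h' := (inner_self_eq_norm_sq (𝕜 := ℂ) (E.K (rankOne ℂ φ φ) φ - Λ φ)).symm.trans h
    rwa [sq_eq_zero_iff, norm_eq_zero, sub_eq_zero] at h'
  intro η
  set s : Fin m → ℝ := fun j => expect (E.dualOp j) φ with hs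
  set b : Fin m → ℝ := fun j => 2 * (inner ℂ η (E.dualOp j φ)).re with hb
  set d : Fin m → ℝ := fun j => expect (E.dualOp j) η with hd
  -- Where M'_jφ = 0 the linear term vanishes too, which keeps the entropy differentiable.
  have hsb : ∀ j, s j = 0 → b j = 0 := fun j hj => by
    simp [hb, apply_eq_zero_of_expect_eq_zero (E.isPositive_dualOp j) hj]
  set N : ℝ → ℝ := fun t => 1 + t * (2 * (inner ℂ η φ).re) + t ^ 2 * ‖η‖ ^ 2 with hN
  -- log 2 times the slack in `expect_le_shannon_add` at φ + tη.
  set G : ℝ → ℝ := fun t => ∑ j, Real.negMulLog (s j + t * b j + t ^ 2 * d j) +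
    (∑ j, (s j + t * b j + t ^ 2 * d j)) * Real.log (N t) -
    (expect Λ φ + t * (2 * (inner ℂ η (Λ φ)).re) + t ^ 2 * expect Λ η) * Real.log 2 with hG
  have hNt : ∀ t : ℝ, ‖φ + (t : ℂ) • η‖ ^ 2 = N t := fun t => by
    rw [← expect_one, expect_add_smul (IsSelfAdjoint.one _), expect_one, expect_one, hφ]
    simp [hN]
  have hG0 : ∀ t, 0 ≤ G t := fun t => by
    have h := mul_le_mul_of_nonneg_right (E.expect_le_shannon_add hle (φ + (t : ℂ) • η)) hlog2.le
    rw [add_mul, shannon_mul_log_two, hNt, expect_add_smul hΛ, mul_assoc, Real.logb,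
      div_mul_cancel₀ _ hlog2.ne'] at h
    simp only [expect_add_smul (hsa _)] at h
    simp only [hG]
    linarith
  have hGz : G 0 = 0 := by
    have h := shannon_mul_log_two s
    rw [heq] at h
    simp [hG, hN, h]
  have hmin : IsLocalMin G 0 := Filter.Eventually.of_forall fun t => by rw [hGz]; exact hG0 t
  have hN' : HasDerivAt N (2 * (inner ℂ η φ).re) 0 := hasDerivAt_quadratic_zero _ _ _
  have hN0 : N 0 = 1 := by simp [hN]
  have hderiv := ((HasDerivAt.fun_sum (u := Finset.univ) fun j _ =>
      hasDerivAt_negMulLog_quadratic (d j) (hsb j)).add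
    ((HasDerivAt.fun_sum (u := Finset.univ) fun j _ =>
      hasDerivAt_quadratic_zero (s j) (b j) (d j)).mul
      (hN'.log (by rw [hN0]; exact one_ne_zero)))).sub
    ((hasDerivAt_quadratic_zero (expect Λ φ) (2 * (inner ℂ η (Λ φ)).re) (expect Λ η)).mul_const
      (Real.log 2))
  have hzero := hmin.hasDerivAt_eq_zero hderiv
  have hssum : ∑ j, s j = 1 := by rw [hs, sum_expect_dualOp, hφP, hφ, one_pow]
  -- By ∑ M'_jφ = φ, the term -∑ b_j of the entropy derivative cancels the derivative of log N.
  have hbsum : ∑ j, b j = 2 * (inner ℂ η φ).re := by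
    rw [hb, ← Finset.mul_sum, ← Complex.re_sum, ← inner_sum, ← sum_apply, sum_dualOp, hφP]
  have hsum : ∑ j, b j * (-Real.log (s j) - 1) = -∑ j, b j * Real.log (s j) - ∑ j, b j := by
    rw [← Finset.sum_neg_distrib, ← Finset.sum_sub_distrib]
    exact Finset.sum_congr rfl fun j _ => by ring
  simp only [zero_mul, ne_eq, OfNat.ofNat_ne_zero, not_false_eq_true, zero_pow, add_zero, hN0,
    Real.log_one, mul_zero, div_one, zero_add, hssum, one_mul, hsum, hbsum] at hzero
  have hK : (inner ℂ η (E.K (rankOne ℂ φ φ) φ)).re =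
      -∑ j, Real.logb 2 (s j) * (inner ℂ η (E.dualOp j φ)).re := by
    simp only [K, neg_apply, sum_apply, smul_apply, inner_neg_right, inner_sum, inner_smul_right,
      Complex.neg_re, Complex.re_sum, Complex.re_ofReal_mul, tr_rankOne_mul, hs]
  have hK2 : ∑ j, b j * Real.log (s j) =
      2 * Real.log 2 * ∑ j, Real.logb 2 (s j) * (inner ℂ η (E.dualOp j φ)).re := by
    rw [Finset.mul_sum]
    refine Finset.sum_congr rfl fun j _ => ?_
    simp only [hb, Real.logb]
    field_simp
  rw [hK]
  have : 2 * Real.log 2 * (-(∑ j, Real.logb 2 (s j) * (inner ℂ η (E.dualOp j φ)).re) -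
      (inner ℂ η (Λ φ)).re) = 0 := by linarith
  have := (mul_eq_zero.1 this).resolve_left (by positivity)
  linarith

theorem average_mul_invSqrt_mul_invSqrt :
    E.average * (invSqrt E.average * invSqrt E.average) = E.supp := by
  calc E.average * (invSqrt E.average * invSqrt E.average)
      = sqrtOp E.average * (sqrtOp E.average * invSqrt E.average) * invSqrt E.average := by
        rw [← mul_assoc, ← mul_assoc, sqrtOp_mul_self E.isPositive_average]
    _ = E.supp := by
        rw [← suppProj, sqrtOp_mul_suppProj]; rfl

theorem supp_mul_K (σ : H →L[ℂ] H) : E.supp * E.K σ = E.K σ := by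
  simp only [K, mul_neg, Finset.mul_sum, mul_smul_comm, supp_mul_dualOp]

theorem EntropyCondition.K_apply_eq {E : Ensemble H m} {n : ℕ} {E₀ : Ensemble H n} {φ : Fin n → H}
    {Λ₀ : H →L[ℂ] H} (h : E.EntropyCondition E₀.weight φ Λ₀) (hφ : ∀ k, ‖φ k‖ = 1)
    (hpure : ∀ k, E₀.state k = rankOne ℂ (φ k) (φ k)) (havg : E₀.average = E.average)
    (hΛ : IsSelfAdjoint Λ₀) {k : Fin n} (hk : 0 < E₀.weight k) :
    E.K (E₀.state k) (φ k) = Λ₀ (φ k) := by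
  have hP := E₀.supp_apply_of_state_eq_rankOne hk (hφ k) (hpure k)
  rw [supp, havg] at hP
  rw [hpure k]
  exact E.K_apply_eq_of_expect_eq hΛ h.1 (hφ k) hP (h.2 k hk)

/-- Stationarity puts Λ₀φ_k into the support, and ρ̄ is a mixture of the |φ_k⟩⟨φ_k|; hence PΛ₀ρ̄ =
Λ₀ρ̄, and Λ₀ commutes with P. On ker P all ⟨η|M'_j|η⟩ vanish, so the entropy inequality reads Λ₀ ≤ 0
there. -/
theorem EntropyCondition.dualFeasible {E : Ensemble H m} {n : ℕ} {E₀ : Ensemble H n}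
    {φ : Fin n → H} {Λ₀ : H →L[ℂ] H} (h : E.EntropyCondition E₀.weight φ Λ₀)
    (hφ : ∀ k, ‖φ k‖ = 1) (hpure : ∀ k, E₀.state k = rankOne ℂ (φ k) (φ k))
    (havg : E₀.average = E.average) (hΛ : IsSelfAdjoint Λ₀) : E.DualFeasible Λ₀ := by
  refine E.dualFeasible_of_expect_le hΛ ?_ (fun η hη => ?_) fun ψ hψ _ => h.1 ψ hψ
  · refine isSelfAdjoint_mul_comm_of_apply hΛ (isSelfAdjoint_suppProj _) ?_
    have hρ : E.supp * Λ₀ * E.average = Λ₀ * E.average := by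
      rw [← havg, average, Finset.mul_sum, Finset.mul_sum]
      refine Finset.sum_congr rfl fun k _ => ?_
      rcases (E₀.weight_nonneg k).eq_or_lt with hk | hk
      · simp [← hk]
      · rw [mul_smul_comm, mul_smul_comm]
        congr 1
        ext x
        simp only [hpure k, mul_apply_eq_comp, rankOne_apply, map_smul]
        rw [← h.K_apply_eq hφ hpure havg hΛ hk, ← mul_apply_eq_comp E.supp, supp_mul_K]
    rw [← E.average_mul_invSqrt_mul_invSqrt, ← mul_assoc, ← mul_assoc Λ₀,
      E.average_mul_invSqrt_mul_invSqrt, hρ]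
  · have h1 := E.expect_le_shannon_add h.1 η
    have h0 : ∀ j, expect (E.dualOp j) η = 0 := fun j => by
      rw [← expect_dualOp_supp, hη, expect_zero]
    simpa [h0, shannon] using h1

end Ensemble

/-! ### Compact convex hulls and supporting hyperplanes -/

/-- By Carathéodory's theorem, d + 1 points suffice, so the hull is a continuous image of a simplex
times s^{d+1}. -/
theorem isCompact_convexHull_of_isCompact {V : Type*} [NormedAddCommGroup V] [NormedSpace ℝ V]
    [FiniteDimensional ℝ V] {s : Set V} (hs : IsCompact s) : IsCompact (convexHull ℝ s) := by
  rcases s.eq_empty_or_nonempty with rfl | ⟨z₀, hz₀⟩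
  · simp
  set d := Module.finrank ℝ V
  have hK : IsCompact (stdSimplex ℝ (Fin (d + 1)) ×ˢ Set.univ.pi fun _ : Fin (d + 1) => s) :=
    (isCompact_stdSimplex ℝ _).prod (isCompact_univ_pi fun _ => hs)
  have hF : Continuous fun q : (Fin (d + 1) → ℝ) × (Fin (d + 1) → V) => ∑ i, q.1 i • q.2 i := by
    fun_prop
  convert! hK.image hF using 1
  refine Set.Subset.antisymm (fun x hx => ?_) ?_
  · obtain ⟨ι, _, z, w, hz, hind, hw, hw1, rfl⟩ := eq_pos_convex_span_of_mem_convexHull hx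
    have hcard : Fintype.card ι ≤ d + 1 :=
      hind.card_le_finrank_succ.trans (Nat.succ_le_succ (Submodule.finrank_le _))
    obtain ⟨e⟩ : Nonempty (ι ↪ Fin (d + 1)) :=
      Function.Embedding.nonempty_of_card_le (by simpa using hcard)
    have hout : ∀ i ∉ Set.range e, Function.extend e w 0 i = 0 := fun i hi => by
      rw [Function.extend_apply' _ _ _ hi]; rfl
    -- Unused slots get weight 0 and the point z₀.
    refine ⟨(Function.extend e w 0, Function.extend e z fun _ => z₀), ⟨⟨fun i => ?_, ?_⟩, ?_⟩, ?_⟩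
    · by_cases hi : i ∈ Set.range e
      · obtain ⟨k, rfl⟩ := hi
        simpa only [e.injective.extend_apply] using (hw k).le
      · exact (hout i hi).ge
    · rw [← hw1]
      exact (Fintype.sum_of_injective e e.injective _ _ hout
        fun i => (e.injective.extend_apply _ _ _).symm).symm
    · intro i _
      by_cases hi : i ∈ Set.range e
      · obtain ⟨k, rfl⟩ := hi
        simp only [e.injective.extend_apply]
        exact hz ⟨k, rfl⟩
      · simp only [Function.extend_apply' _ _ _ hi]
        exact hz₀
    · refine (Fintype.sum_of_injective e e.injective _ _ (fun i hi => ?_) fun i => ?_).symm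
      · simp only [hout i hi, zero_smul]
      · simp only [e.injective.extend_apply]
  · rintro _ ⟨⟨w, z⟩, ⟨⟨hw0, hw1⟩, hz⟩, rfl⟩
    exact mem_convexHull_of_exists_fintype w z hw0 hw1 (fun i => hz i trivial) rfl

/-- A nonvertical supporting hyperplane of a convex set of normalized points, pulled back along a
linear map `T`, at a point `T e` that is interior in the sense of `hdense`. -/
theorem exists_supporting_functional {V W : Type*} [AddCommGroup V] [Module ℝ V] [AddCommGroup W]
    [Module ℝ W] (T : V →ₗ[ℝ] W) {C : Set (W × ℝ)} (hC : Convex ℝ C) (τ : W →ₗ[ℝ] ℝ)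
    (hτ : ∀ p ∈ C, τ p.1 = 1) {e : V} {v : ℝ} (he : τ (T e) = 1)
    (hv : ∀ y, (T e, y) ∈ C → v ≤ y)
    (hdense : ∀ A, ∃ a : ℝ, ∃ c : ℝ, 0 ≤ c ∧ ∃ p ∈ C, T (A + a • e) = c • p.1) :
    ∃ l : V →ₗ[ℝ] ℝ, l e = v ∧
      ∀ A c p, 0 ≤ c → p ∈ C → T A = c • p.1 → l A ≤ c * p.2 := by
  obtain ⟨_, _, _, p₀, hp₀, _⟩ := hdense 0
  -- The epigraph of C made homogeneous, pulled back along T.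
  let s : PointedCone ℝ (V × ℝ) :=
    { carrier := {q | ∃ c : ℝ, 0 ≤ c ∧ ∃ p ∈ C, T q.1 = c • p.1 ∧ c * p.2 ≤ q.2}
      zero_mem' := ⟨0, le_rfl, p₀, hp₀, by simp⟩
      add_mem' := by
        rintro q q' ⟨c, hc, p, hp, h1, h2⟩ ⟨c', hc', p', hp', h1', h2'⟩
        rcases (add_nonneg hc hc').eq_or_lt with h0 | h0
        · obtain rfl : c = 0 := by linarith
          obtain rfl : c' = 0 := by linarith
          refine ⟨0, le_rfl, p, hp, ?_, ?_⟩
          · rw [Prod.fst_add, map_add, h1, h1']; simp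
          · simp only [zero_mul, Prod.snd_add] at *; linarith
        · refine ⟨c + c', h0.le, _, hC hp hp' (div_nonneg hc h0.le) (div_nonneg hc' h0.le)
            (by rw [← add_div, div_self h0.ne']), ?_, ?_⟩
          · rw [Prod.fst_add, map_add, h1, h1', Prod.fst_add, Prod.smul_fst, Prod.smul_fst,
              smul_add, smul_smul, smul_smul, mul_div_cancel₀ _ h0.ne', mul_div_cancel₀ _ h0.ne']
          · rw [Prod.snd_add, Prod.snd_add, Prod.smul_snd, Prod.smul_snd, smul_eq_mul, smul_eq_mul,
              mul_add, ← mul_assoc, ← mul_assoc, mul_div_cancel₀ _ h0.ne',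
              mul_div_cancel₀ _ h0.ne']
            exact add_le_add h2 h2'
      smul_mem' := by
        rintro r q ⟨c, hc, p, hp, h1, h2⟩
        refine ⟨r * c, mul_nonneg r.2 hc, p, hp, ?_, ?_⟩
        · change T ((r : ℝ) • q.1) = _
          rw [map_smul, h1, smul_smul]
        · change _ ≤ (r : ℝ) * q.2
          rw [mul_assoc]
          exact mul_le_mul_of_nonneg_left h2 r.2 }
  -- On ℝe × ℝ this is (ae, y) ↦ y - va, nonnegative on the cone because v is a lower bound over T
  -- e.
  let F : V × ℝ →ₗ[ℝ] ℝ := LinearMap.snd ℝ V ℝ - v • (τ ∘ₗ T ∘ₗ LinearMap.fst ℝ V ℝ)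
  have hF : ∀ q : V × ℝ, F q = q.2 - v * τ (T q.1) := fun q => rfl
  let f : V × ℝ →ₗ.[ℝ] ℝ := ⟨(Submodule.span ℝ {e}).prod ⊤, F.domRestrict _⟩
  have hnonneg : ∀ x : f.domain, (x : V × ℝ) ∈ s → 0 ≤ f x := by
    rintro ⟨⟨A, y⟩, hA, _⟩ ⟨c, hc, p, hp, h1, h2⟩
    obtain ⟨a, rfl⟩ := Submodule.mem_span_singleton.1 hA
    change 0 ≤ F (a • e, y)
    dsimp only at h1 h2
    rw [hF, map_smul, map_smul, he]
    have hac : a = c := by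
      have := congrArg τ h1
      simpa [he, hτ p hp] using this
    subst hac
    rcases hc.eq_or_lt with h0 | h0
    · simp [← h0] at h2 ⊢
      exact h2
    · rw [map_smul] at h1
      have hTe : T e = p.1 := smul_right_injective _ h0.ne' h1
      have := mul_le_mul_of_nonneg_left (hv p.2 (by rw [hTe]; exact hp)) hc
      rw [smul_eq_mul, mul_one]
      dsimp only
      linarith
  have hdense' : ∀ y, ∃ x : f.domain, (x : V × ℝ) + y ∈ s := by
    rintro ⟨A, y⟩
    obtain ⟨a, c, hc, p, hp, h⟩ := hdense A
    refine ⟨⟨(a • e, c * p.2 - y), Submodule.smul_mem _ _ (Submodule.mem_span_singleton_self e),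
      trivial⟩, c, hc, p, hp, ?_, ?_⟩
    · rw [← h, add_comm A]; rfl
    · simp
  obtain ⟨g, hg, hgs⟩ := riesz_extension s f hnonneg hdense'
  have hg' : ∀ a y : ℝ, g (a • e, y) = y - v * a := fun a y => by
    have := hg ⟨(a • e, y), Submodule.smul_mem _ _ (Submodule.mem_span_singleton_self e), trivial⟩
    refine this.trans ((hF _).trans ?_)
    simp [he]
  -- The extension has the form g(A, y) = y - l(A).
  refine ⟨-(g ∘ₗ LinearMap.inl ℝ V ℝ), ?_, fun A c p hc hp h => ?_⟩
  · have := hg' 1 0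
    simp only [one_smul] at this
    simp [this]
  · have h1 := hgs (A, c * p.2) ⟨c, hc, p, hp, h, le_rfl⟩
    have h2 := hg' 0 (c * p.2)
    have h3 : ((A, c * p.2) : V × ℝ) = (A, 0) + ((0 : ℝ) • e, c * p.2) := by simp
    rw [h3, map_add, h2] at h1
    simp only [LinearMap.neg_apply, LinearMap.comp_apply, LinearMap.inl_apply]
    linarith

instance finiteDimensional_real_operators : FiniteDimensional ℝ (H →L[ℂ] H) :=
  FiniteDimensional.complexToReal _

/-- Real-linear functionals on operators are represented by the trace pairing. -/
theorem exists_eq_tr_mul (l : (H →L[ℂ] H) →ₗ[ℝ] ℝ) : ∃ L : H →L[ℂ] H, ∀ A, l A = tr (A * L) := by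
  let B : (H →L[ℂ] H) →ₗ[ℝ] Module.Dual ℝ (H →L[ℂ] H) :=
    LinearMap.mk₂ ℝ (fun L A => tr (A * L)) (fun L L' A => by rw [mul_add, tr_add])
      (fun c L A => by rw [← Complex.coe_smul, mul_smul_comm, tr_smul]; rfl)
      (fun L A A' => by rw [add_mul, tr_add])
      (fun c L A => by rw [← Complex.coe_smul, smul_mul_assoc, tr_smul]; rfl)
  have hinj : Function.Injective B := by
    rw [← LinearMap.ker_eq_bot, LinearMap.ker_eq_bot']
    intro L hL
    have h : tr (star L * L) = 0 := LinearMap.congr_fun hL (star L)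
    have h0 := eq_zero_of_tr_eq_zero (ContinuousLinearMap.isPositive_adjoint_comp_self L) h
    exact CStarRing.star_mul_self_eq_zero_iff L |>.1 h0
  have hsurj : Function.Surjective B :=
    (LinearMap.injective_iff_surjective_of_finrank_eq_finrank
      Subspace.dual_finrank_eq.symm).1 hinj
  obtain ⟨L, hL⟩ := hsurj l
  exact ⟨L, fun A => by rw [← hL]; rfl⟩

/-! ### Strong duality -/

namespace Ensemble

/-- The ensemble of pure states with given vectors and weights. -/
@[simps]
noncomputable def ofVectors {n : ℕ} (w : Fin n → ℝ) (φ : Fin n → H) (hw : ∀ i, 0 ≤ w i)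
    (hw1 : ∑ i, w i = 1) (hφ : ∀ i, ‖φ i‖ = 1) : Ensemble H n where
  weight := w
  state i := rankOne ℂ (φ i) (φ i)
  weight_nonneg := hw
  weight_sum := hw1
  isState i := isState_rankOne (hφ i)

variable {m : ℕ} (E : Ensemble H m)

/-- The convex hull of the graph of the output entropy over the pure states. -/
noncomputable def entropyHull : Set ((H →L[ℂ] H) × ℝ) :=
  convexHull ℝ ((fun ψ : H => (rankOne ℂ ψ ψ, E.outputEntropy (rankOne ℂ ψ ψ))) ''
    Metric.sphere 0 1)

theorem isCompact_entropyHull : IsCompact E.entropyHull := by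
  have : ProperSpace H := FiniteDimensional.proper ℂ H
  refine isCompact_convexHull_of_isCompact ((isCompact_sphere 0 1).image ?_)
  simp only [outputEntropy_rankOne]
  have hlog : ∀ q : Fin m → ℝ, shannon q = (∑ j, Real.negMulLog (q j)) / Real.log 2 := fun q => by
    rw [← shannon_mul_log_two, mul_div_cancel_right₀ _ (Real.log_pos one_lt_two).ne']
  have hrank : Continuous fun ψ : H => rankOne ℂ ψ ψ :=
    (ContinuousLinearMap.smulRightL ℂ H H).continuous₂.comp
      ((innerSL ℂ).continuous.prodMk continuous_id)
  simp only [hlog, expect]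
  fun_prop

theorem mem_entropyHull {n : ℕ} {w : Fin n → ℝ} {φ : Fin n → H} (hw : ∀ i, 0 ≤ w i)
    (hw1 : ∑ i, w i = 1) (hφ : ∀ i, ‖φ i‖ = 1) :
    (∑ i, (w i : ℂ) • rankOne ℂ (φ i) (φ i),
      ∑ i, w i * E.outputEntropy (rankOne ℂ (φ i) (φ i))) ∈ E.entropyHull := by
  refine mem_convexHull_of_exists_fintype w _ hw hw1
    (fun i => ⟨φ i, by simpa using hφ i, rfl⟩) (Prod.ext ?_ ?_)
  · simp [Prod.fst_sum]
  · simp [Prod.snd_sum]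

theorem exists_mem_entropyHull {σ : H →L[ℂ] H} (hσ : IsState σ) :
    ∃ y, (σ, y) ∈ E.entropyHull := by
  obtain ⟨n, w, φ, hw, hw1, hφ, rfl⟩ := hσ.exists_pure_decomposition
  exact ⟨_, E.mem_entropyHull hw hw1 hφ⟩

theorem tr_eq_one_of_mem_entropyHull {p : (H →L[ℂ] H) × ℝ} (hp : p ∈ E.entropyHull) :
    tr p.1 = 1 := by
  obtain ⟨ι, _, w, z, -, hw1, hz, rfl⟩ := mem_convexHull_iff_exists_fintype.1 hp
  rw [← trLinear_apply, Prod.fst_sum, map_sum, ← hw1]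
  refine Finset.sum_congr rfl fun i _ => ?_
  obtain ⟨ψ, hψ, h⟩ := hz i
  rw [mem_sphere_zero_iff_norm] at hψ
  rw [← h, Prod.smul_fst, map_smul, trLinear_apply, tr_rankOne, hψ]
  simp

theorem exists_isPure_of_mem_entropyHull {y : ℝ} (h : (E.average, y) ∈ E.entropyHull) :
    ∃ (n : ℕ) (E' : Ensemble H n), E'.average = E.average ∧ E'.IsPure ∧ E.primalValue E' = y := by
  obtain ⟨ι, _, w, z, hw, hw1, hz, hsum⟩ := mem_convexHull_iff_exists_fintype.1 h
  choose φ hφ hφz using hz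
  simp only [mem_sphere_zero_iff_norm] at hφ
  let e := (Fintype.equivFin ι).symm
  refine ⟨Fintype.card ι, ofVectors (fun i => w (e i)) (fun i => φ (e i)) (fun i => hw _)
    (by rw [← hw1]; exact e.sum_comp w) fun i => hφ _, ?_, fun k => ⟨_, hφ _, rfl⟩, ?_⟩
  · rw [← show _ = E.average from congrArg Prod.fst hsum, average, Prod.fst_sum,
      ← e.sum_comp fun i => (w i • z i).1]
    exact Finset.sum_congr rfl fun i _ => by simp [← hφz]
  · rw [← show _ = y from congrArg Prod.snd hsum, primalValue_eq, Prod.snd_sum,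
      ← e.sum_comp fun i => (w i • z i).2]
    exact Finset.sum_congr rfl fun i _ => by simp [← hφz]

/-- Conjugation of the self-adjoint part by the square root of the average state. -/
noncomputable def conjSqrt : (H →L[ℂ] H) →ₗ[ℝ] (H →L[ℂ] H) where
  toFun A := sqrtOp E.average * ((1 / 2 : ℝ) • (A + star A)) * sqrtOp E.average
  map_add' A B := by
    rw [← add_mul, ← mul_add, ← smul_add, star_add]; congr 3; abel
  map_smul' c A := by
    rw [star_smul, star_trivial, ← smul_add, smul_comm, mul_smul_comm, smul_mul_assoc]; rfl

theorem conjSqrt_apply (A : H →L[ℂ] H) :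
    E.conjSqrt A = sqrtOp E.average * ((1 / 2 : ℝ) • (A + star A)) * sqrtOp E.average := rfl

theorem conjSqrt_of_isSelfAdjoint {A : H →L[ℂ] H} (hA : IsSelfAdjoint A) :
    E.conjSqrt A = sqrtOp E.average * A * sqrtOp E.average := by
  rw [conjSqrt_apply, hA.star_eq, ← two_smul ℝ A, smul_smul]; norm_num

theorem conjSqrt_one : E.conjSqrt 1 = E.average := by
  rw [conjSqrt_of_isSelfAdjoint _ (IsSelfAdjoint.one _), mul_one,
    sqrtOp_mul_self E.isPositive_average]

/-- The identity is an order unit. As `conjSqrt` sends it to ρ̄, ρ̄ behaves as an interior point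
even if degenerate, and the supporting hyperplane is not vertical. -/
theorem exists_conjSqrt_add_isPositive (A : H →L[ℂ] H) :
    ∃ a : ℝ, (E.conjSqrt (A + a • (1 : H →L[ℂ] H))).IsPositive := by
  set S := (1 / 2 : ℝ) • (A + star A) with hS
  have hSsa : IsSelfAdjoint S := (IsSelfAdjoint.all _).smul (IsSelfAdjoint.add_star_self A)
  have hone : IsSelfAdjoint (1 : H →L[ℂ] H) := IsSelfAdjoint.one _
  refine ⟨‖S‖, ?_⟩
  have h : E.conjSqrt (A + ‖S‖ • (1 : H →L[ℂ] H)) =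
      sqrtOp E.average * (S + ‖S‖ • (1 : H →L[ℂ] H)) * sqrtOp E.average := by
    rw [map_add, conjSqrt_of_isSelfAdjoint _ ((IsSelfAdjoint.all ‖S‖).smul hone), conjSqrt_apply,
      ← hS, mul_add, add_mul]
  rw [h]
  refine isPositive_conj (isSelfAdjoint_sqrtOp _) ?_
  rw [← ContinuousLinearMap.nonneg_iff_isPositive, ← neg_le_iff_add_nonneg]
  have := hSsa.neg_algebraMap_norm_le_self
  rwa [Algebra.algebraMap_eq_smul_one] at this

/-- Existence of a feasible operator whose dual value is at least the optimum over pure states. -/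
theorem exists_dualFeasible {v : ℝ} (hv : ∀ y, (E.average, y) ∈ E.entropyHull → v ≤ y) :
    ∃ Λ, E.DualFeasible Λ ∧ v ≤ tr (E.average * Λ) := by
  obtain ⟨l, hl1, hl⟩ := exists_supporting_functional E.conjSqrt (C := E.entropyHull)
    (convex_convexHull ℝ _) trLinear (fun p hp => E.tr_eq_one_of_mem_entropyHull hp) (e := 1)
    (v := v) (by rw [conjSqrt_one, trLinear_apply, E.isState_average.tr_eq_one])
    (by rwa [conjSqrt_one]) (fun A => by
      obtain ⟨a, ha⟩ := E.exists_conjSqrt_add_isPositive A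
      obtain ⟨σ, hσ, h⟩ := exists_eq_smul_isState E.isState_average ha
      obtain ⟨y, hy⟩ := E.exists_mem_entropyHull hσ
      refine ⟨a, _, tr_nonneg ha, (σ, y), hy, ?_⟩
      exact h.trans (Complex.coe_smul _ _))
  obtain ⟨L₀, hL₀⟩ := exists_eq_tr_mul l
  set Q := invSqrt E.average with hQ
  have hQsa : IsSelfAdjoint Q := isSelfAdjoint_invSqrt _
  set L := (1 / 2 : ℝ) • (L₀ + star L₀) with hL
  have hLsa : IsSelfAdjoint L := (IsSelfAdjoint.all _).smul (IsSelfAdjoint.add_star_self L₀)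
  have hexp : ∀ ψ, expect (Q * L * Q) ψ = l (rankOne ℂ (Q ψ) (Q ψ)) := fun ψ => by
    have hstar : ∀ χ : H, expect (star L₀) χ = expect L₀ χ := fun χ => by
      rw [expect, ContinuousLinearMap.star_eq_adjoint, ContinuousLinearMap.adjoint_inner_right,
        ← inner_conj_symm, Complex.conj_re, expect]
    rw [expect_conj hQsa, hL, ← Complex.coe_smul, expect_ofReal_smul, expect_add, hstar, hL₀,
      tr_rankOne_mul]
    ring
  -- By `hexp` the form of QLQ at ψ is l(|Qψ⟩⟨Qψ|), and for ψ in the support `conjSqrt` takes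
  -- |Qψ⟩⟨Qψ| back to |ψ⟩⟨ψ|.
  refine ⟨Q * L * Q, E.dualFeasible_of_expect_le ?_ ?_ (fun η hη => ?_) fun ψ hψ hψP => ?_, ?_⟩
  · rw [IsSelfAdjoint, star_mul, star_mul, hQsa.star_eq, hLsa.star_eq, mul_assoc]
  · rw [mul_assoc, hQ, invSqrt_mul_suppProj, mul_assoc, ← mul_assoc E.supp, suppProj_mul_invSqrt]
  · have : Q η = 0 := by
      rw [hQ, ← invSqrt_mul_suppProj, mul_apply_eq_comp, hη, map_zero]
    rw [hexp, this]; simp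
  · have hRQ : sqrtOp E.average (Q ψ) = ψ := by
      rw [← mul_apply_eq_comp]; exact hψP
    have hmem := E.mem_entropyHull (n := 1) (w := fun _ => 1) (φ := fun _ => ψ)
      (fun _ => zero_le_one) (by simp) fun _ => hψ
    have := hl (rankOne ℂ (Q ψ) (Q ψ)) 1 _ zero_le_one hmem (by
      rw [conjSqrt_of_isSelfAdjoint _ (isPositive_rankOne_self _).isSelfAdjoint,
        conj_rankOne (isSelfAdjoint_sqrtOp _), hRQ]
      simp)
    rw [hexp, ← outputEntropy_rankOne]
    simpa using this
  · have hval : tr (E.average * (Q * L * Q)) = l E.supp := by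
      obtain ⟨n, u, hu⟩ := ContinuousLinearMap.isPositive_iff_eq_sum_rankOne.1 E.isPositive_average
      rw [show E.supp = Q * E.average * Q from
        (invSqrt_mul_op_mul_invSqrt E.isPositive_average).symm]
      -- Q depends on ρ̄ as well; only the explicit ρ̄ is to be expanded.
      clear_value Q
      rw [hu, Finset.sum_mul, tr_sum, Finset.mul_sum, Finset.sum_mul, map_sum]
      exact Finset.sum_congr rfl fun i _ => by rw [tr_rankOne_mul, hexp, conj_rankOne hQsa]
    obtain ⟨y, hy⟩ := E.exists_mem_entropyHull E.isState_average
    -- `conjSqrt` kills 1 - P, so l(1 - P) ≤ 0 and l(P) ≥ l(1) = v; the point of the hull is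
    -- irrelevant at c = 0.
    have := hl (1 - E.supp) 0 _ le_rfl hy (by
      rw [conjSqrt_of_isSelfAdjoint _ ((IsSelfAdjoint.one _).sub (isSelfAdjoint_suppProj _)),
        mul_sub, mul_one, sqrtOp_mul_suppProj, sub_self, zero_mul, zero_smul])
    rw [map_sub, hl1] at this
    rw [hval]
    linarith

/-- Strong duality, with attainment on both sides. -/
theorem exists_strong_duality : ∃ Λ, E.DualFeasible Λ ∧ ∃ (n : ℕ) (E' : Ensemble H n),
    E'.average = E.average ∧ E'.IsPure ∧ E.primalValue E' = tr (E.average * Λ) := by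
  have hcomp : IsCompact (Prod.mk E.average ⁻¹' E.entropyHull) :=
    (Topology.IsClosedEmbedding.of_continuous_injective_isClosedMap (by fun_prop)
      (Prod.mk_right_injective _) (isClosedMap_prodMk_left _)).isCompact_preimage
      E.isCompact_entropyHull
  obtain ⟨v, hv, hmin⟩ := hcomp.exists_isLeast (E.exists_mem_entropyHull E.isState_average)
  obtain ⟨Λ, hΛ, hle⟩ := E.exists_dualFeasible hmin
  obtain ⟨n, E', havg, hpure, hval⟩ := E.exists_isPure_of_mem_entropyHull hv
  refine ⟨Λ, hΛ, n, E', havg, hpure, le_antisymm (hval.trans_le hle) (hΛ.tr_average_mul_le havg)⟩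

end Ensemble

/-- Mutual information as input entropy minus conditional entropy. -/
theorem sum_mul_logb_div_eq {m n : ℕ} {π : Fin m → ℝ} {p : Fin m → Fin n → ℝ}
    (hp : ∀ j k, 0 ≤ p j k) (hπ : ∀ j, ∑ k, p j k = π j) :
    ∑ j, ∑ k, p j k * Real.logb 2 (p j k / (π j * ∑ i, p i k)) =
      shannon π - ∑ k, (shannon (fun j => p j k) +
        (∑ j, p j k) * Real.logb 2 (∑ j, p j k)) := by
  have key : ∀ j k, p j k * Real.logb 2 (p j k / (π j * ∑ i, p i k)) =
      p j k * Real.logb 2 (p j k) - p j k * Real.logb 2 (π j) -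
        p j k * Real.logb 2 (∑ i, p i k) := by
    intro j k
    rcases (hp j k).eq_or_lt with h | h
    · simp [← h]
    · have h1 : 0 < π j :=
        h.trans_le (hπ j ▸ Finset.single_le_sum (fun k _ => hp j k) (Finset.mem_univ k))
      have h2 : 0 < ∑ i, p i k :=
        h.trans_le (Finset.single_le_sum (fun i _ => hp i k) (Finset.mem_univ j))
      rw [Real.logb_div h.ne' (mul_pos h1 h2).ne', Real.logb_mul h1.ne' h2.ne']
      ring
  simp only [key, Finset.sum_sub_distrib, shannon, Finset.sum_add_distrib, Finset.sum_neg_distrib,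
    ← Finset.sum_mul, hπ]
  rw [Finset.sum_comm (f := fun j k => p j k * Real.logb 2 (p j k)),
    Finset.sum_comm (f := fun j k => p j k * Real.logb 2 (∑ i, p i k))]
  simp only [← Finset.sum_mul]
  ring

/-! ### Mutual information and ensemble-observable duality -/

namespace Ensemble

variable {m : ℕ} (E : Ensemble H m)

theorem jointProb_eq {n : ℕ} (M : Observable H n) (j : Fin m) (k : Fin n) :
    jointProb E M j k = tr (sqrtOp E.average * M.op k * sqrtOp E.average * E.dualOp j) := by
  rw [jointProb, ← tr_smul, ← smul_mul_assoc, ← sqrtOp_mul_dualOp_mul_sqrtOp, mul_assoc, mul_assoc,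
    tr_mul_comm, tr_mul_comm _ (E.dualOp j)]
  simp only [mul_assoc]

theorem sum_jointProb {n : ℕ} (M : Observable H n) (j : Fin m) :
    ∑ k, jointProb E M j k = E.weight j := by
  simp only [jointProb]
  rw [← Finset.mul_sum, ← tr_sum, ← Finset.mul_sum, M.sum_eq_one, mul_one, (E.isState j).tr_eq_one,
    mul_one]

theorem sum_conj_sqrtOp {n : ℕ} (M : Observable H n) :
    ∑ k, sqrtOp E.average * M.op k * sqrtOp E.average = E.average := by
  rw [← Finset.sum_mul, ← Finset.mul_sum, M.sum_eq_one, mul_one,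
    sqrtOp_mul_self E.isPositive_average]

/-- The mutual information in terms of the dual ensemble. -/
theorem mutualInfo_eq {n : ℕ} (M : Observable H n) {p : Fin n → ℝ} {σ : Fin n → H →L[ℂ] H}
    (hσ : ∀ k, IsState (σ k))
    (h : ∀ k, sqrtOp E.average * M.op k * sqrtOp E.average = (p k : ℂ) • σ k) :
    mutualInfo E M = shannon E.weight - ∑ k, p k * E.outputEntropy (σ k) := by
  have hP : ∀ j k, jointProb E M j k = p k * tr (σ k * E.dualOp j) := fun j k => by
    rw [jointProb_eq, h, smul_mul_assoc, tr_smul]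
  have hpos : ∀ j k, 0 ≤ jointProb E M j k := fun j k => by
    rw [jointProb_eq]
    exact E.tr_mul_dualOp_nonneg (isPositive_conj (isSelfAdjoint_sqrtOp _) (M.isPositive k)) j
  -- The states σ_k with p_k = 0 may leave the support; the factor p_k covers them.
  have hnorm : ∀ k, p k * ∑ j, tr (σ k * E.dualOp j) = p k := fun k => by
    rw [sum_tr_mul_dualOp, ← tr_smul, ← smul_mul_assoc, ← h, mul_assoc, sqrtOp_mul_suppProj, h,
      tr_smul, (hσ k).tr_eq_one, mul_one]
  rw [mutualInfo, sum_mul_logb_div_eq hpos (E.sum_jointProb M)]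
  congr 1
  refine Finset.sum_congr rfl fun k _ => ?_
  simp only [hP, ← Finset.mul_sum, hnorm, shannon_mul, outputEntropy]
  rw [← mul_assoc, mul_comm _ (p k), hnorm]
  ring

theorem DualFeasible.mutualInfo_le {E : Ensemble H m} {Λ : H →L[ℂ] H} (hΛ : E.DualFeasible Λ)
    {n : ℕ} (M : Observable H n) :
    mutualInfo E M ≤ shannon E.weight - tr (E.average * Λ) := by
  have hpos := fun k => isPositive_conj (isSelfAdjoint_sqrtOp E.average) (M.isPositive k)
  choose σ hσ h using fun k => exists_eq_smul_isState E.isState_average (hpos k)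
  rw [E.mutualInfo_eq M hσ h]
  refine sub_le_sub_left ?_ _
  conv_lhs => rw [← E.sum_conj_sqrtOp M, Finset.sum_mul, tr_sum]
  refine Finset.sum_le_sum fun k _ => ?_
  conv_lhs => rw [h k, smul_mul_assoc, tr_smul]
  exact mul_le_mul_of_nonneg_left (hΛ.tr_mul_le (hσ k)) (tr_nonneg (hpos k))

/-- The observable dual to a decomposition of the average state. -/
noncomputable def dualObservable {n : ℕ} (E' : Ensemble H n) (h : E'.average = E.average) :
    Observable H (n + 1) where
  op := Fin.cons (1 - E.supp) fun k =>
    invSqrt E.average * ((E'.weight k : ℂ) • E'.state k) * invSqrt E.average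
  isPositive k := by
    refine Fin.cases ?_ (fun k => ?_) k
    · exact isPositive_one_sub_suppProj _
    · exact isPositive_conj (isSelfAdjoint_invSqrt _)
        (isPositive_ofReal_smul (E'.weight_nonneg k) (E'.isState k).isPositive)
  sum_eq_one := by
    rw [Fin.sum_univ_succ]
    simp only [Fin.cons_zero, Fin.cons_succ]
    rw [← Finset.sum_mul, ← Finset.mul_sum, ← average, h,
      invSqrt_mul_op_mul_invSqrt E.isPositive_average, sub_add_cancel]

theorem mutualInfo_dualObservable {n : ℕ} (E' : Ensemble H n) (h : E'.average = E.average) :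
    mutualInfo E (E.dualObservable E' h) = shannon E.weight - E.primalValue E' := by
  -- The extra outcome 1 - P has probability zero; ρ̄ is a dummy state for it.
  rw [E.mutualInfo_eq (E.dualObservable E' h) (p := Fin.cons 0 E'.weight)
    (σ := Fin.cons E.average E'.state), Fin.sum_univ_succ, primalValue_eq]
  · simp
  · exact fun k => Fin.cases E.isState_average E'.isState k
  · refine fun k => Fin.cases ?_ (fun k => ?_) k
    · simp only [dualObservable, Fin.cons_zero]
      rw [mul_sub, mul_one, sqrtOp_mul_suppProj, sub_self, zero_mul, Complex.ofReal_zero, zero_smul]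
    · simp only [dualObservable, Fin.cons_succ]
      have h1 := E'.supp_mul_weight_smul_state k
      have h2 := E'.weight_smul_state_mul_supp k
      rw [supp, h] at h1 h2
      calc _ = (sqrtOp E.average * invSqrt E.average) * ((E'.weight k : ℂ) • E'.state k) *
            (invSqrt E.average * sqrtOp E.average) := by simp only [mul_assoc]
        _ = _ := by rw [invSqrt_mul_sqrtOp, ← suppProj, h1, h2]

theorem isGreatest_mutualInfoValues {Λ : H →L[ℂ] H} (hΛ : E.DualFeasible Λ) {n : ℕ}
    {E' : Ensemble H n} (h : E'.average = E.average)
    (hval : E.primalValue E' = tr (E.average * Λ)) :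
    IsGreatest (mutualInfoValues E) (shannon E.weight - tr (E.average * Λ)) := by
  refine ⟨⟨n + 1, E.dualObservable E' h, by rw [mutualInfo_dualObservable, hval]⟩, ?_⟩
  rintro _ ⟨l, M, rfl⟩
  exact hΛ.mutualInfo_le M

/-! ### Complementary slackness and the equivalences -/

theorem primalValue_sub_eq {n : ℕ} {E₀ : Ensemble H n} {φ : Fin n → H}
    (hpure : ∀ k, E₀.state k = rankOne ℂ (φ k) (φ k)) (havg : E₀.average = E.average)
    (Λ : H →L[ℂ] H) : E.primalValue E₀ - tr (E.average * Λ) =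
      ∑ k, E₀.weight k * ((shannon fun j => expect (E.dualOp j) (φ k)) - expect Λ (φ k)) := by
  rw [← havg, tr_average_mul, primalValue_eq, ← Finset.sum_sub_distrib]
  refine Finset.sum_congr rfl fun k _ => ?_
  rw [hpure k, outputEntropy_rankOne, tr_rankOne_mul, mul_sub]

theorem DualFeasible.entropyCondition_iff {E : Ensemble H m} {Λ : H →L[ℂ] H}
    (hΛ : E.DualFeasible Λ) {n : ℕ} {E₀ : Ensemble H n} {φ : Fin n → H} (hφ : ∀ k, ‖φ k‖ = 1)
    (hpure : ∀ k, E₀.state k = rankOne ℂ (φ k) (φ k)) (havg : E₀.average = E.average) :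
    E.EntropyCondition E₀.weight φ Λ ↔ E.primalValue E₀ = tr (E.average * Λ) := by
  rw [← sub_eq_zero, E.primalValue_sub_eq hpure havg, Finset.sum_eq_zero_iff_of_nonneg fun k _ =>
    mul_nonneg (E₀.weight_nonneg k) (sub_nonneg.2 (hΛ.expect_le (hφ k)))]
  constructor
  · intro h k _
    rcases (E₀.weight_nonneg k).eq_or_lt with hk | hk
    · rw [← hk, zero_mul]
    · rw [h.2 k hk, sub_self, mul_zero]
  · intro h
    refine ⟨fun ψ hψ => hΛ.expect_le hψ, fun k hk => ?_⟩
    exact sub_eq_zero.1 ((mul_eq_zero.1 (h k (Finset.mem_univ k))).resolve_left hk.ne')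

end Ensemble

end AccessibleInfo

theorem theorem1 {H : Type*} [NormedAddCommGroup H] [InnerProductSpace ℂ H] [CompleteSpace H]
    [FiniteDimensional ℂ H] {m : ℕ} (E : AccessibleInfo.Ensemble H m) :
    -- duality: both problems are solvable, with the same optimal value
    (∃ v : ℝ,
      IsLeast {x | ∃ (n : ℕ) (E' : AccessibleInfo.Ensemble H n),
        E'.average = E.average ∧ E.primalValue E' = x} v ∧
      IsLeast {x | ∃ (n : ℕ) (E' : AccessibleInfo.Ensemble H n),
        E'.average = E.average ∧ E'.IsPure ∧ E.primalValue E' = x} v ∧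
      IsGreatest {x | ∃ Λ : H →L[ℂ] H,
        E.DualFeasible Λ ∧ AccessibleInfo.tr (E.average * Λ) = x} v) ∧
    -- the optimality criteria
    ∀ (n : ℕ) (E₀ : AccessibleInfo.Ensemble H n) (φ : Fin n → H) (Λ₀ : H →L[ℂ] H),
      (∀ k, ‖φ k‖ = 1) →
      (∀ k, E₀.state k = InnerProductSpace.rankOne ℂ (φ k) (φ k)) →
      E₀.average = E.average →
      IsSelfAdjoint Λ₀ →
      List.TFAE [
        E.SolvesPrimal E₀ ∧ E.SolvesDual Λ₀,
        E.SolvesPurePrimal E₀ ∧ E.SolvesDual Λ₀,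
        (∀ σ, AccessibleInfo.IsState σ → E.LeK Λ₀ σ) ∧
          ∀ k, 0 < E₀.weight k →
            φ k ∈ E.domK (E₀.state k) ∧ (E.K (E₀.state k) - Λ₀) (φ k) = 0,
        E.EntropyCondition E₀.weight φ Λ₀] ∧
      -- the value of the accessible information
      (E.EntropyCondition E₀.weight φ Λ₀ →
        IsGreatest (AccessibleInfo.mutualInfoValues E) (AccessibleInfo.accessibleInfo E) ∧
        AccessibleInfo.accessibleInfo E =
          AccessibleInfo.shannon E.weight - AccessibleInfo.tr (E.average * Λ₀)) := by
  obtain ⟨Λ, hΛ, n₁, E₁, havg₁, hpure₁, hval₁⟩ := E.exists_strong_duality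
  refine ⟨⟨AccessibleInfo.tr (E.average * Λ), ⟨⟨n₁, E₁, havg₁, hval₁⟩, ?_⟩,
    ⟨⟨n₁, E₁, havg₁, hpure₁, hval₁⟩, ?_⟩, ⟨⟨Λ, hΛ, rfl⟩, ?_⟩⟩, ?_⟩
  · rintro _ ⟨n, E', h, rfl⟩
    exact hΛ.tr_average_mul_le h
  · rintro _ ⟨n, E', h, -, rfl⟩
    exact hΛ.tr_average_mul_le h
  · rintro _ ⟨Λ', hΛ', rfl⟩
    exact hval₁ ▸ hΛ'.tr_average_mul_le havg₁
  intro n E₀ φ Λ₀ hφ hpure havg hsa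
  refine ⟨?_, fun h => ?_⟩
  · tfae_have 1 → 2 := fun ⟨h1, h2⟩ =>
      ⟨⟨havg, fun k => ⟨φ k, hφ k, hpure k⟩, fun l E' h _ => h1.2 l E' h⟩, h2⟩
    tfae_have 2 → 4 := by
      rintro ⟨h1, h2⟩
      rw [h2.1.entropyCondition_iff hφ hpure havg]
      -- Comparison with the pair of equal values from strong duality closes the gap.
      exact le_antisymm ((h1.2.2 _ E₁ havg₁ hpure₁).trans (hval₁.trans_le (h2.2 Λ hΛ)))
        (h2.1.tr_average_mul_le havg)
    tfae_have 4 → 3 := by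
      refine fun h => ⟨(h.dualFeasible hφ hpure havg hsa).2, fun k hk => ⟨?_, ?_⟩⟩
      · rw [hpure k]
        exact E.mem_domK_rankOne (φ k)
      · rw [sub_apply, h.K_apply_eq hφ hpure havg hsa hk, sub_self]
    tfae_have 3 → 1 := by
      rintro ⟨h1, h2⟩
      have hf : E.DualFeasible Λ₀ := ⟨hsa, h1⟩
      have hval : E.primalValue E₀ = AccessibleInfo.tr (E.average * Λ₀) := by
        rw [← hf.entropyCondition_iff hφ hpure havg]
        refine ⟨fun ψ hψ => hf.expect_le hψ, fun k hk => ?_⟩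
        rw [← E.outputEntropy_rankOne, ← E.tr_self_mul_K, AccessibleInfo.tr_rankOne_mul, ← hpure k,
          ← sub_eq_zero, ← AccessibleInfo.expect_sub, AccessibleInfo.expect, (h2 k hk).2]
        simp
      exact ⟨⟨havg, fun l E' h => hval.trans_le (hf.tr_average_mul_le h)⟩, hf,
        fun Λ' hΛ' => hval ▸ hΛ'.tr_average_mul_le havg⟩
    tfae_finish
  · have hf := h.dualFeasible hφ hpure havg hsa
    have hg := E.isGreatest_mutualInfoValues hf havg
      ((hf.entropyCondition_iff hφ hpure havg).1 h)
    have hacc : AccessibleInfo.accessibleInfo E =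
        AccessibleInfo.shannon E.weight - AccessibleInfo.tr (E.average * Λ₀) := hg.csSup_eq
    exact ⟨hacc ▸ hg, hacc⟩
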